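/- Let $\mathbb M$ be a finite non-empty set of phases and let $\{D_k\}_{k\ge 0}$ be real $\mathbb M\times\mathbb M$ matrices characterizing a batch Markovian arrival process (BMAP): $D_k\ge O$ for $k\ge 1$, the off-diagonal elements of $D_0$ are nonnegative, $D:=\sum_{k\ge 0}D_k$ converges and is an irreducible generator with $De=0$, and $D_k\ne O$ for some $k\ge1$ (here $e$ is the column vector of ones, and $\mathrm e$ is Napier's constant). Let $\mu>0$ and consider the BMAP/M/$\infty$ queue with service rate $\mu$, i.e. the generator $Q=(q(k,i;\ell,j))$ on $\mathbb S=\mathbb Z_+\times\mathbb M$ with blocks $$Q_{k,\ell}=D_{\ell-k}\ (\ell>k),\qquad Q_{k,k}=D_0-k\mu I,\qquad Q_{k,k-1}=k\mu I\ (k\ge1),\qquad Q_{k,\ell}=O\ (\ell<k-1).$$ Suppose that for some $C>0$ $$\sum_{k=1}^{\infty}(k+\mathrm e)\log(k+\mathrm e)\,D_k e< C e ,$$ and put $V(x)=(x+\mathrm e)\log(x+\mathrm e)$ for $x\ge 0$ and, for $c>0$, $v^{(c)}(k,i)=c\log(k+\mathrm e)$, so that $v^{(c)}_k=c\log(k+\mathrm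 e)\,e$. Then: 1. (Drift.) There are $K\in\mathbb Z_+$ and $\theta>0$ such that, with convergent series, $$\sum_{\ell=0}^{\infty}Q_{k,\ell}V(\ell)e\le-\theta V(k)e\le -e\qquad\text{for all }k\ge K+1.$$ 2. (Condition 1.) $Q$ is irreducible, and for every $c$ with $c\mu>1$ (in particular for $c=1$ if $\mu>1$) the vector $v=v^{(c)}$ satisfies $\inf v>0$ and $Qv\le -e+b\,1_{\mathbb C}$ for some $b\in(0,\infty)$ and some finite set $\mathbb C\subset\mathbb S$. 3. (Condition 2.) There is exactly one probability vector $\pi$ on $\mathbb S$ with $\pi Q=0$; it is positive, and for every $c>0$ (in particular for $v_k=\log(k+\mathrm e)e$) $$\sum_{(k,i)\in\mathbb S}\pi(k,i)\,|q(k,i;k,i)|\,v^{(c)}(k,i)<\infty .$$ 4. (The algorithm applies.) Let $c>0$ and $v=v^{(c)}$. Define recursively $$U^*_{0,0}=U_0^*=(-Q_{0,0})^{-1},\qquad U_n^*=U^*_{n,n}=\Bigl(-Q_{n,n}-Q_{n,n-1}\sum_{\ell=0}^{n-1}U^*_{n-1,\ell}Q_{\ell,n}\Bigr)^{-1},\qquad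 U^*_{n,k}=U^*_nQ_{n,n-1}U^*_{n-1,k}\ (k<n),$$ $$u_0^*=U_0^*e,\qquad u_n^*=U_n^*(e+Q_{n,n-1}u^*_{n-1}),\qquad y_n=v_n+\sum_{k=0}^nU^*_{n,k}\sum_{\ell=n+1}^\infty Q_{k,\ell}v_\ell .$$ All these inverses exist, the series in $y_n$ converge, and $u_n^*>0$, $y_n>0$. For any choice of $j_n^*\in\operatorname{argmin}_{j\in\mathbb M}y_n(j)/u_n^*(j)$, $n\ge0$, let ${}_{(n)}\hat\pi^*$ be the vector on $\mathbb S$ whose level-$k$ part is the $j_n^*$-th row of $U^*_{n,k}$ divided by $u_n^*(j_n^*)$ for $k\le n$, and zero for $k>n$. Then each ${}_{(n)}\hat\pi^*$ is a probability vector and $$\lim_{n\to\infty}\|{}_{(n)}\hat\pi^*-\pi\|=0,\qquad \|m\|:=\sum_x|m(x)| .$$ Consequently, for each $\varepsilon\in(0,1)$ and each strictly increasing sequence $n_0<n_1<\cdots$ of positive integers, the stopping criterion $\|{}_{(n_\ell)}\hat\pi^*-{}_{(n_{\ell-1})}\hat\pi^*\|<\varepsilon$ is met for some $\ell\ge1$.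 -/

import Mathlib

open Filter Topology

noncomputable section

namespace BlockHessenberg

/-- Irreducibility of a (generator) matrix `q`: every state reaches every other state along
transitions `a → b`, `a ≠ b`, of positive rate. -/
def IsIrreducibleGenerator {S : Type*} (q : S → S → ℝ) : Prop :=
  ∀ x y : S, Relation.ReflTransGen (fun a b => a ≠ b ∧ 0 < q a b) x y

/-- `p` is a probability vector with `p q = 0`. -/
structure IsStationaryDistribution {S : Type*} (q : S → S → ℝ) (p : S → ℝ) : Prop where
  nonneg : ∀ x, 0 ≤ p x
  hasSum_one : HasSum p 1
  balance : ∀ y, HasSum (fun x => p x * q x y) 0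

/-- Foster-Lyapunov drift condition with the vector `v`: the generator `q` is irreducible, `v` is
positive and bounded away from zero, and `q v ≤ -e + b 1_C` for some `b > 0` and some finite
set `C` of states (where the series in `q v` converge). -/
structure DriftCondition {S : Type*} (q : S → S → ℝ) (v : S → ℝ) : Prop where
  irreducible : IsIrreducibleGenerator q
  inf_pos : ∃ δ : ℝ, 0 < δ ∧ ∀ x, δ ≤ v x
  summable : ∀ x, Summable (fun y => q x y * v y)
  drift : ∃ b : ℝ, 0 < b ∧ ∃ C : Finset S, ∀ x,
    ∑' y, q x y * v y ≤ -1 + b * Set.indicator (C : Set S) (fun _ => (1 : ℝ)) x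

/-- Moment condition `∑ₙ πₙ Δₙ vₙ < ∞`, where `Δ` is the diagonal matrix of the `|q x x|`. -/
def MomentCondition {S : Type*} (q : S → S → ℝ) (p v : S → ℝ) : Prop :=
  Summable (fun x => p x * |q x x| * v x)

section Algorithm

variable {ι : Type*} [Fintype ι] [DecidableEq ι]

/-- The matrix on `ℕ × ι` (level, phase) with blocks `Q k l`. -/
def ofBlocks (Q : ℕ → ℕ → Matrix ι ι ℝ) : ℕ × ι → ℕ × ι → ℝ :=
  fun x y => Q x.1 y.1 x.2 y.2

/-- `-Q_{n+1,n+1} - Q_{n+1,n} ∑_{l ≤ n} U_l Q_{l,n+1}`. -/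
def pivotOf (Q : ℕ → ℕ → Matrix ι ι ℝ) (n : ℕ) (U : ℕ → Matrix ι ι ℝ) : Matrix ι ι ℝ :=
  -Q (n + 1) (n + 1) - Q (n + 1) n * ∑ l ∈ Finset.range (n + 1), U l * Q l (n + 1)

/-- The matrices `U*_{n,k}`, `0 ≤ k ≤ n` (and `0` for `k > n`); `U*_n` is `U*_{n,n}`. -/
def Ustar (Q : ℕ → ℕ → Matrix ι ι ℝ) : ℕ → ℕ → Matrix ι ι ℝ
  | 0, k => if k = 0 then (-Q 0 0)⁻¹ else 0
  | n + 1, k =>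
      if k = n + 1 then (pivotOf Q n (Ustar Q n))⁻¹
      else if k ≤ n then (pivotOf Q n (Ustar Q n))⁻¹ * Q (n + 1) n * Ustar Q n k
      else 0

/-- The matrix that is inverted in step `n` of the algorithm to get `U*_n`. -/
def pivot (Q : ℕ → ℕ → Matrix ι ι ℝ) : ℕ → Matrix ι ι ℝ
  | 0 => -Q 0 0
  | n + 1 => pivotOf Q n (Ustar Q n)

/-- `u*_0 = U*_0 e` and `u*_n = U*_n (e + Q_{n,n-1} u*_{n-1})`. -/
def uStar (Q : ℕ → ℕ → Matrix ι ι ℝ) : ℕ → ι → ℝ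
  | 0 => (Ustar Q 0 0).mulVec (fun _ => 1)
  | n + 1 => (Ustar Q (n + 1) (n + 1)).mulVec
      ((fun _ => 1) + (Q (n + 1) n).mulVec (uStar Q n))

/-- The terms `Q_{k,l} v_l`, `l = n+1+m`, of the tail series `∑_{l > n} Q_{k,l} v_l`. -/
def tailTerm (Q : ℕ → ℕ → Matrix ι ι ℝ) (v : ℕ × ι → ℝ) (n k m : ℕ) : ι → ℝ :=
  (Q k (n + 1 + m)).mulVec (fun j => v (n + 1 + m, j))

/-- `y_n = v_n + ∑_{k ≤ n} U*_{n,k} ∑_{l > n} Q_{k,l} v_l`. -/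
def yVec (Q : ℕ → ℕ → Matrix ι ι ℝ) (v : ℕ × ι → ℝ) (n : ℕ) (i : ι) : ℝ :=
  v (n, i) + ∑ k ∈ Finset.range (n + 1),
    (Ustar Q n k).mulVec (fun j => ∑' m, tailTerm Q v n k m j) i

/-- `j n` minimises `y_n / u*_n` over the phases, for every `n`. -/
def IsArgmin (Q : ℕ → ℕ → Matrix ι ι ℝ) (v : ℕ × ι → ℝ) (j : ℕ → ι) : Prop :=
  ∀ n i, yVec Q v n (j n) / uStar Q n (j n) ≤ yVec Q v n i / uStar Q n i

/-- The approximation computed by the algorithm at truncation level `n`: on level `k ≤ n` it is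
row `j n` of `U*_{n,k}` divided by `u*_n (j n)`, and it is zero above level `n`. -/
def approx (Q : ℕ → ℕ → Matrix ι ι ℝ) (j : ℕ → ι) (n : ℕ) : ℕ × ι → ℝ :=
  fun x => if x.1 ≤ n then Ustar Q n x.1 (j n) x.2 / uStar Q n (j n) else 0

/-- Total variation norm `∑ |p x - p' x|` of the difference of two summable vectors. -/
def tvDist {S : Type*} (p p' : S → ℝ) : ℝ := ∑' x, |p x - p' x|

/-- The sequential update algorithm, run with the vector `v` on the generator with blocks `Q`,
works and computes `p`: every step is well defined; whatever minimisers `j n` are chosen,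
the computed vectors are probability vectors that converge to `p` in total variation, and for each
tolerance `ε` and each sequence `N` of check points the stopping criterion is met. -/
structure AlgorithmApplies (Q : ℕ → ℕ → Matrix ι ι ℝ) (v p : ℕ × ι → ℝ) : Prop where
  isUnit_pivot : ∀ n, IsUnit (pivot Q n)
  uStar_pos : ∀ n i, 0 < uStar Q n i
  tail_summable : ∀ n k i, k ≤ n → Summable (fun m => tailTerm Q v n k m i)
  yVec_pos : ∀ n i, 0 < yVec Q v n i
  approx_nonneg : ∀ j, IsArgmin Q v j → ∀ n x, 0 ≤ approx Q j n x
  approx_hasSum : ∀ j, IsArgmin Q v j → ∀ n, HasSum (approx Q j n) 1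
  converges : ∀ j, IsArgmin Q v j →
    Tendsto (fun n => tvDist (approx Q j n) p) atTop (𝓝 0)
  terminates : ∀ j, IsArgmin Q v j → ∀ ε : ℝ, 0 < ε → ε < 1 →
    ∀ N : ℕ → ℕ, StrictMono N → (∀ l, 0 < N l) →
      ∃ l, 1 ≤ l ∧ tvDist (approx Q j (N l)) (approx Q j (N (l - 1))) < ε

end Algorithm

section BMAP

variable {ι : Type*} [Fintype ι] [DecidableEq ι]

/-- `D` characterises a batch Markovian arrival process with phase set `ι`: `D_k ≥ 0` for `k ≥ 1`,
`D_0` is nonnegative off the diagonal, `∑_k D_k` converges and is an irreducible conservative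
generator, and batches do arrive. -/
structure IsBMAP (D : ℕ → Matrix ι ι ℝ) : Prop where
  nonneg : ∀ k, 1 ≤ k → ∀ i j, 0 ≤ D k i j
  offDiag_nonneg : ∀ i j, i ≠ j → 0 ≤ D 0 i j
  summable : ∀ i j, Summable (fun k => D k i j)
  conservative : ∀ i, ∑ j, ∑' k, D k i j = 0
  irreducible : IsIrreducibleGenerator (fun i j => ∑' k, D k i j)
  arrivals : ∃ k, 1 ≤ k ∧ D k ≠ 0

/-- Blocks `Q_{k,l}` of the generator of the BMAP/M/∞ queue with service rate `μ`. -/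
def bmapBlocks (D : ℕ → Matrix ι ι ℝ) (μ : ℝ) (k l : ℕ) : Matrix ι ι ℝ :=
  if k < l then D (l - k)
  else if k = l then D 0 - ((k : ℝ) * μ) • (1 : Matrix ι ι ℝ)
  else if k = l + 1 then ((k : ℝ) * μ) • (1 : Matrix ι ι ℝ)
  else 0

/-- `V(x) = (x + e) log (x + e)`. -/
def lyapV (x : ℝ) : ℝ := (x + Real.exp 1) * Real.log (x + Real.exp 1)

/-- The vector with `v(k,i) = c log (k + e)`. -/
def logVec (c : ℝ) : ℕ × ι → ℝ := fun x => c * Real.log ((x.1 : ℝ) + Real.exp 1)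

end BMAP

end BlockHessenberg

end

/-!
Since the chain descends at most one level at a time, the matrices `U*_{n,k}` form the last block
row of the inverse of the truncation of `-Q` to the levels up to `n`. By irreducibility the chain
leaves these levels from every state, so the truncation is a weakly chained diagonally dominant
Z-matrix: it is nonsingular, and its inverse is nonnegative. Each approximation is thus a row of
this inverse, normalized to a probability vector, and satisfies all balance equations below
level `n`.

A drift inequality `Q V ≤ -θ V + b` with `V` increasing in the level bounds the `V`-moment of the
approximations by `b / θ`, whatever phases are chosen: the transitions lost by the truncation all
lead to larger values of `V`. The approximations are therefore tight, and each of their limit points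
is a stationary distribution with finite `V`-moment. As the total rates are `O(V)`, the pointwise
minimum of that distribution with any other one is again invariant, which gives uniqueness, and
Scheffé's lemma turns pointwise convergence into convergence in total variation.

In the queue, departures from level `k` occur at rate `k μ` and lower `V` by at least
`log (k + e)` each, while arrivals raise `V` at a rate of at most `3 log (k + e)` times the moment
of the batch sizes; for the logarithm, the drift is at most `-μ + O(1 / k)`.
-/

namespace BlockHessenberg

open scoped Matrix

section WeaklyChainedDominant

variable {n R : Type*} [Fintype n] [Field R] [LinearOrder R] [IsStrictOrderedRing R]

/-- Weakly chained diagonally dominant Z-matrices: the off-diagonal entries are nonpositive, the row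
sums are nonnegative, and from every index a chain of negative off-diagonal entries leads to a row
with positive sum. They are nonsingular, with an entrywise nonnegative inverse. -/
structure IsWeaklyChainedDominant (A : Matrix n n R) : Prop where
  offDiag_nonpos : ∀ i j, i ≠ j → A i j ≤ 0
  rowSum_nonneg : ∀ i, 0 ≤ ∑ j, A i j
  chained : ∀ i, ∃ j, Relation.ReflTransGen (fun a b => a ≠ b ∧ A a b < 0) i j ∧ 0 < ∑ k, A j k

namespace IsWeaklyChainedDominant

variable {A : Matrix n n R}

theorem rowSum_nonpos_and_eq_of_isMin (hA : IsWeaklyChainedDominant A) {z : n → R} {a : n}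
    (hz : 0 ≤ (A *ᵥ z) a) (hmin : ∀ b, z a ≤ z b) (hneg : z a < 0) :
    ∑ k, A a k ≤ 0 ∧ ∀ b, A a b < 0 → z b = z a := by
  have hterm : ∀ b ∈ Finset.univ, A a b * (z b - z a) ≤ 0 := by
    intro b _
    rcases eq_or_ne a b with rfl | hab
    · simp
    · exact mul_nonpos_of_nonpos_of_nonneg (hA.offDiag_nonpos a b hab) (sub_nonneg.2 (hmin b))
  have hsplit : (A *ᵥ z) a = z a * ∑ k, A a k + ∑ k, A a k * (z k - z a) := by
    simp only [Matrix.mulVec, dotProduct, Finset.mul_sum, ← Finset.sum_add_distrib]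
    exact Finset.sum_congr rfl fun k _ => by ring
  rw [hsplit] at hz
  have hrow : z a * ∑ k, A a k ≤ 0 :=
    mul_nonpos_of_nonpos_of_nonneg hneg.le (hA.rowSum_nonneg a)
  have hsum := Finset.sum_nonpos hterm
  refine ⟨?_, fun b hAab => ?_⟩
  · by_contra! hpos
    linarith [mul_neg_of_neg_of_pos hneg hpos]
  · have hzero := (Finset.sum_eq_zero_iff_of_nonpos hterm).1 (by linarith) b (Finset.mem_univ b)
    exact sub_eq_zero.1 ((mul_eq_zero.1 hzero).resolve_left hAab.ne)

theorem nonneg_of_mulVec_nonneg (hA : IsWeaklyChainedDominant A) {z : n → R} (hz : 0 ≤ A *ᵥ z) :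
    0 ≤ z := by
  by_contra hnot
  obtain ⟨i, hi⟩ : ∃ i, z i < 0 := by simpa [Pi.le_def] using hnot
  have : Nonempty n := ⟨i⟩
  obtain ⟨i₀, hmin⟩ := Finite.exists_min z
  have hneg : z i₀ < 0 := (hmin i).trans_lt hi
  have key (a : n) (ha : z a = z i₀) :=
    hA.rowSum_nonpos_and_eq_of_isMin (hz a) (fun b => ha ▸ hmin b) (ha ▸ hneg)
  obtain ⟨j, hchain, hpos⟩ := hA.chained i₀
  have hj : z j = z i₀ := by
    clear hpos
    induction hchain with
    | refl => rfl
    | tail _ hbc ih => exact ((key _ ih).2 _ hbc.2).trans ih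
  exact (key j hj).1.not_gt hpos

variable [DecidableEq n]

theorem isUnit (hA : IsWeaklyChainedDominant A) : IsUnit A := by
  rw [← Matrix.mulVec_injective_iff_isUnit]
  intro z w hzw
  have hle : ∀ {a b : n → R}, A *ᵥ a = A *ᵥ b → b ≤ a := fun hab =>
    sub_nonneg.1 (hA.nonneg_of_mulVec_nonneg (by rw [Matrix.mulVec_sub, hab, sub_self]))
  exact le_antisymm (hle hzw.symm) (hle hzw)

theorem inv_mul_self (hA : IsWeaklyChainedDominant A) : A⁻¹ * A = 1 :=
  Matrix.nonsing_inv_mul _ ((Matrix.isUnit_iff_isUnit_det _).1 hA.isUnit)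

theorem inv_nonneg (hA : IsWeaklyChainedDominant A) (i j : n) : 0 ≤ A⁻¹ i j := by
  have hcol : 0 ≤ A⁻¹ *ᵥ Pi.single j 1 := by
    refine hA.nonneg_of_mulVec_nonneg ?_
    rw [Matrix.mulVec_mulVec,
      Matrix.mul_nonsing_inv _ ((Matrix.isUnit_iff_isUnit_det _).1 hA.isUnit), Matrix.one_mulVec]
    exact Pi.single_nonneg.2 zero_le_one
  simpa using hcol i

theorem sum_inv_pos (hA : IsWeaklyChainedDominant A) (i : n) : 0 < ∑ j, A⁻¹ i j := by
  refine (Finset.sum_nonneg fun j _ => hA.inv_nonneg i j).lt_of_ne fun hsum => ?_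
  have hrow := (Finset.sum_eq_zero_iff_of_nonneg fun j _ => hA.inv_nonneg i j).1 hsum.symm
  have hone : (A⁻¹ * A) i i = 1 := by rw [hA.inv_mul_self, Matrix.one_apply_eq]
  rw [Matrix.mul_apply, Finset.sum_eq_zero fun j hj => by rw [hrow j hj, zero_mul]] at hone
  exact zero_ne_one hone

end IsWeaklyChainedDominant

end WeaklyChainedDominant

section Generator

variable {S : Type*} {q : S → S → ℝ}

/-- Generators of continuous-time Markov chains on `S`: nonnegative rates off the diagonal and
vanishing row sums. -/
structure IsConservativeGenerator (q : S → S → ℝ) : Prop where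
  offDiag_nonneg : ∀ x y, x ≠ y → 0 ≤ q x y
  hasSum_row : ∀ x, HasSum (q x) 0

/-- Nonnegative solutions of `m q = 0`, not required to have finite mass. -/
structure IsInvariantVector (q : S → S → ℝ) (m : S → ℝ) : Prop where
  nonneg : ∀ x, 0 ≤ m x
  balance : ∀ y, HasSum (fun x => m x * q x y) 0

theorem IsStationaryDistribution.isInvariantVector {p : S → ℝ}
    (hp : IsStationaryDistribution q p) : IsInvariantVector q p :=
  ⟨hp.nonneg, hp.balance⟩

namespace IsInvariantVector

variable {m r : S → ℝ}

theorem const_mul (hm : IsInvariantVector q m) {c : ℝ} (hc : 0 ≤ c) :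
    IsInvariantVector q (fun x => c * m x) where
  nonneg x := mul_nonneg hc (hm.nonneg x)
  balance y := by simpa only [mul_assoc, mul_zero] using (hm.balance y).mul_left c

theorem sub (hr : IsInvariantVector q r) (hm : IsInvariantVector q m) (h : ∀ x, m x ≤ r x) :
    IsInvariantVector q (fun x => r x - m x) where
  nonneg x := sub_nonneg.2 (h x)
  balance y := by simpa only [sub_mul, sub_zero] using (hr.balance y).sub (hm.balance y)

end IsInvariantVector

namespace IsConservativeGenerator

variable {m p r : S → ℝ}

theorem eq_zero_of_apply_eq_zero (hq : IsConservativeGenerator q) (hirr : IsIrreducibleGenerator q)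
    (hm : IsInvariantVector q m) {y : S} (hy : m y = 0) (x : S) : m x = 0 := by
  have step : ∀ a b, 0 < q a b → m b = 0 → m a = 0 := by
    intro a b hab hb
    have hterm : ∀ x, 0 ≤ m x * q x b := by
      intro x
      rcases eq_or_ne x b with rfl | hx
      · simp [hb]
      · exact mul_nonneg (hm.nonneg x) (hq.offDiag_nonneg x b hx)
    have hzero := congrFun ((hasSum_zero_iff_of_nonneg hterm).1 (hm.balance b)) a
    exact (mul_eq_zero.1 hzero).resolve_right hab.ne'
  induction hirr x y using Relation.ReflTransGen.head_induction_on with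
  | refl => exact hy
  | head hab _ ih => exact step _ _ hab.2 ih

theorem pos_of_isStationaryDistribution (hq : IsConservativeGenerator q)
    (hirr : IsIrreducibleGenerator q) (hp : IsStationaryDistribution q p) (x : S) : 0 < p x := by
  refine (hp.nonneg x).lt_of_ne fun hx => ?_
  have hzero : p = 0 :=
    funext (hq.eq_zero_of_apply_eq_zero hirr hp.isInvariantVector hx.symm)
  exact zero_ne_one (hasSum_zero.unique (hzero ▸ hp.hasSum_one))

theorem hasSum_abs_row (hq : IsConservativeGenerator q) (x : S) :
    HasSum (fun y => |q x y|) (2 * |q x x|) := by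
  classical
  have hdiag : q x x ≤ 0 := by
    simpa using sum_le_hasSum {x}
      (fun y hy => hq.offDiag_nonneg x y fun h => hy (by simp [h])) (hq.hasSum_row x)
  have hsum := (hq.hasSum_row x).add (hasSum_ite_eq x (2 * |q x x|))
  rw [zero_add] at hsum
  convert hsum using 2 with y
  rcases eq_or_ne y x with rfl | hy
  · simp only [abs_of_nonpos hdiag, if_true]
    ring
  · simp [hy, abs_of_nonneg (hq.offDiag_nonneg x y hy.symm)]

theorem summable_mul_of_summable_mul_abs_diag (hq : IsConservativeGenerator q)
    (hrate : Summable fun x => m x * |q x x|) : Summable fun z : S × S => m z.1 * q z.1 z.2 := by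
  have hrow (x : S) : HasSum (fun y => |m x * q x y|) (|m x| * (2 * |q x x|)) := by
    simpa only [abs_mul] using (hq.hasSum_abs_row x).mul_left |m x|
  refine Summable.of_abs ((summable_prod_of_nonneg fun _ => abs_nonneg _).2
    ⟨fun x => (hrow x).summable, ?_⟩)
  simp only [fun x => (hrow x).tsum_eq]
  refine (hrate.abs.mul_left 2).congr fun x => ?_
  rw [abs_mul, abs_abs]
  ring

/- The total mass of `m q` vanishes, because the row sums of `q` do and the order of summation may
be exchanged when the total rate of `m` is finite. -/
theorem isInvariantVector_of_subinvariant (hq : IsConservativeGenerator q) (hm : ∀ x, 0 ≤ m x)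
    (hrate : Summable fun x => m x * |q x x|) (hsub : ∀ y, ∑' x, m x * q x y ≤ 0) :
    IsInvariantVector q m := by
  have hs := hq.summable_mul_of_summable_mul_abs_diag hrate
  have htotal : ∑' y, ∑' x, m x * q x y = 0 := by
    calc ∑' y, ∑' x, m x * q x y = ∑' x, ∑' y, m x * q x y := hs.tsum_comm
      _ = ∑' _ : S, 0 := by simp only [tsum_mul_left, (hq.hasSum_row _).tsum_eq, mul_zero]
      _ = 0 := tsum_zero
  have hcol : Summable fun y => ∑' x, m x * q x y := hs.prod_symm.prod
  have hneg : HasSum (fun y => -∑' x, m x * q x y) 0 := by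
    simpa only [htotal, neg_zero] using hcol.hasSum.neg
  have hzero := (hasSum_zero_iff_of_nonneg fun y => neg_nonneg.2 (hsub y)).1 hneg
  refine ⟨hm, fun y => ?_⟩
  rw [← neg_eq_zero.1 (congrFun hzero y)]
  exact (hs.prod_symm.prod_factor y).hasSum

theorem tsum_mul_nonpos_of_le (hq : IsConservativeGenerator q) (hr : IsInvariantVector q r)
    (hle : ∀ x, m x ≤ r x) {y : S} (hy : m y = r y) : ∑' x, m x * q x y ≤ 0 := by
  by_cases hsum : Summable (fun x => m x * q x y)
  · rw [← (hr.balance y).tsum_eq]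
    refine hsum.tsum_le_tsum (fun x => ?_) (hr.balance y).summable
    rcases eq_or_ne x y with rfl | hx
    · rw [hy]
    · exact mul_le_mul_of_nonneg_right (hle x) (hq.offDiag_nonneg x y hx)
  · rw [tsum_eq_zero_of_not_summable hsum]

theorem isInvariantVector_min (hq : IsConservativeGenerator q) (hp : IsInvariantVector q p)
    (hr : IsInvariantVector q r) (hrate : Summable fun x => p x * |q x x|) :
    IsInvariantVector q (fun x => min (p x) (r x)) := by
  have hmin : ∀ x, 0 ≤ min (p x) (r x) := fun x => le_min (hp.nonneg x) (hr.nonneg x)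
  refine hq.isInvariantVector_of_subinvariant hmin ?_ fun y => ?_
  · exact Summable.of_nonneg_of_le (fun x => mul_nonneg (hmin x) (abs_nonneg _))
      (fun x => mul_le_mul_of_nonneg_right (min_le_left _ _) (abs_nonneg _)) hrate
  · rcases le_total (p y) (r y) with h | h
    · exact hq.tsum_mul_nonpos_of_le hp (fun x => min_le_left _ _) (min_eq_left h)
    · exact hq.tsum_mul_nonpos_of_le hr (fun x => min_le_right _ _) (min_eq_right h)

/- The minimum of the two vectors is invariant as well, and its differences from them vanish at
`y`, hence everywhere. -/
theorem eq_of_apply_eq (hq : IsConservativeGenerator q) (hirr : IsIrreducibleGenerator q)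
    (hp : IsInvariantVector q p) (hr : IsInvariantVector q r)
    (hrate : Summable fun x => p x * |q x x|) {y : S} (hy : p y = r y) : p = r := by
  have hm := hq.isInvariantVector_min hp hr hrate
  funext x
  have hpx := hq.eq_zero_of_apply_eq_zero hirr (hp.sub hm fun x => min_le_left _ _)
    (y := y) (by simp [hy]) x
  have hrx := hq.eq_zero_of_apply_eq_zero hirr (hr.sub hm fun x => min_le_right _ _)
    (y := y) (by simp [hy]) x
  linarith

theorem isStationaryDistribution_unique (hq : IsConservativeGenerator q)
    (hirr : IsIrreducibleGenerator q) (hp : IsStationaryDistribution q p)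
    (hr : IsStationaryDistribution q r) (hrate : Summable fun x => p x * |q x x|) : r = p := by
  obtain ⟨y⟩ : Nonempty S := by
    by_contra hne
    rw [not_nonempty_iff] at hne
    exact zero_ne_one (hasSum_empty.unique hp.hasSum_one)
  have hry := hq.pos_of_isStationaryDistribution hirr hr y
  have hprop : p = fun x => p y / r y * r x :=
    hq.eq_of_apply_eq hirr hp.isInvariantVector
      (hr.isInvariantVector.const_mul (div_nonneg (hp.nonneg y) hry.le)) hrate
      (div_mul_cancel₀ _ hry.ne').symm
  have hmass := hr.hasSum_one.mul_left (p y / r y)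
  rw [← hprop, mul_one] at hmass
  have hratio := hp.hasSum_one.unique hmass
  rw [hprop, ← hratio]
  simp only [one_mul]

end IsConservativeGenerator

end Generator

section FiniteRestriction

variable {S F : Type*} [Fintype F] {q : S → S → ℝ} {e : F ↪ S}

/-- The matrix `-q` restricted to the states listed by `e`. For a generator `q` that can leave these
states, its inverse is the Green matrix of the chain killed on leaving them. -/
def negRestriction (q : S → S → ℝ) (e : F ↪ S) : Matrix F F ℝ :=
  Matrix.of fun a b => -q (e a) (e b)

omit [Fintype F] in
theorem negRestriction_apply (a b : F) : negRestriction q e a b = -q (e a) (e b) := rfl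

namespace IsConservativeGenerator

theorem sum_restriction_mul_le (hq : IsConservativeGenerator q) {f : S → ℝ} {c : ℝ}
    (hc : ∀ x ∉ Set.range e, c ≤ f x) {a : F} (hsum : Summable fun y => q (e a) y * f y) :
    ∑ b, q (e a) (e b) * (f (e b) - c) ≤ ∑' y, q (e a) y * f y := by
  have hshift : HasSum (fun y => q (e a) y * (f y - c)) (∑' y, q (e a) y * f y) := by
    simpa only [mul_sub, zero_mul, sub_zero] using
      hsum.hasSum.sub ((hq.hasSum_row (e a)).mul_right c)
  rw [← Finset.sum_map Finset.univ e fun y => q (e a) y * (f y - c)]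
  refine sum_le_hasSum _ (fun y hy => ?_) hshift
  have hye : y ∉ Set.range e := by simpa using hy
  exact mul_nonneg (hq.offDiag_nonneg _ _ fun h => hye ⟨a, h⟩) (sub_nonneg.2 (hc y hye))

theorem rowSum_negRestriction_nonneg (hq : IsConservativeGenerator q) (e : F ↪ S) (a : F) :
    0 ≤ ∑ b, negRestriction q e a b := by
  have hsum := hq.sum_restriction_mul_le (e := e) (f := fun _ => 1) (c := 0) (a := a)
    (fun _ _ => zero_le_one) (by simpa only [mul_one] using (hq.hasSum_row (e a)).summable)
  simp only [mul_one, sub_zero, (hq.hasSum_row (e a)).tsum_eq] at hsum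
  simpa only [negRestriction_apply, Finset.sum_neg_distrib, neg_nonneg] using hsum

theorem rowSum_negRestriction_pos (hq : IsConservativeGenerator q) {a : F} {y : S}
    (hy : y ∉ Set.range e) (hay : 0 < q (e a) y) : 0 < ∑ b, negRestriction q e a b := by
  classical
  have hsum := sum_le_hasSum (insert y (Finset.univ.map e)) (fun z hz =>
    hq.offDiag_nonneg (e a) z fun h => hz (by simp [← h])) (hq.hasSum_row (e a))
  rw [Finset.sum_insert (by simpa using hy), Finset.sum_map] at hsum
  simp only [negRestriction_apply, Finset.sum_neg_distrib]
  linarith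

theorem isWeaklyChainedDominant_negRestriction (hq : IsConservativeGenerator q)
    (hirr : IsIrreducibleGenerator q) {y : S} (hy : y ∉ Set.range e) :
    IsWeaklyChainedDominant (negRestriction q e) where
  offDiag_nonpos a b hab := neg_nonpos.2 (hq.offDiag_nonneg _ _ (e.injective.ne hab))
  rowSum_nonneg := hq.rowSum_negRestriction_nonneg e
  chained a := by
    suffices hchain : ∀ x, Relation.ReflTransGen (fun a b => a ≠ b ∧ 0 < q a b) x y →
        ∀ a, e a = x → ∃ j, Relation.ReflTransGen
          (fun a b => a ≠ b ∧ negRestriction q e a b < 0) a j ∧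
          0 < ∑ k, negRestriction q e j k from hchain _ (hirr (e a) y) a rfl
    intro x hxy
    induction hxy using Relation.ReflTransGen.head_induction_on with
    | refl => exact fun a ha => absurd ⟨a, ha⟩ hy
    | @head x z hxz _ ih =>
      rintro a rfl
      by_cases hz : z ∈ Set.range e
      · obtain ⟨c, rfl⟩ := hz
        obtain ⟨j, hcj, hj⟩ := ih c rfl
        exact ⟨j, hcj.head ⟨fun h => hxz.1 (congrArg e h), neg_lt_zero.2 hxz.2⟩, hj⟩
      · exact ⟨a, .refl, hq.rowSum_negRestriction_pos hz hxz.2⟩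

/- The Green matrix is nonnegative and maps `-q (f - c)`, which the drift inequality bounds from
below on the restriction, to `f - c`. -/
theorem green_mul_le_of_drift [DecidableEq F] (hq : IsConservativeGenerator q)
    (hA : IsWeaklyChainedDominant (negRestriction q e)) {f : S → ℝ} {c θ b : ℝ}
    (hc : ∀ x ∉ Set.range e, c ≤ f x) (hsum : ∀ a, Summable fun y => q (e a) y * f y)
    (hdrift : ∀ a, ∑' y, q (e a) y * f y ≤ -θ * f (e a) + b) (a : F) :
    θ * ∑ d, (negRestriction q e)⁻¹ a d * f (e d) ≤
      b * ∑ d, (negRestriction q e)⁻¹ a d + (f (e a) - c) := by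
  have hle (d : F) : θ * f (e d) - b ≤ (negRestriction q e *ᵥ fun d => f (e d) - c) d := by
    have hd := (hq.sum_restriction_mul_le hc (hsum d)).trans (hdrift d)
    simp only [Matrix.mulVec, dotProduct, negRestriction_apply, neg_mul, Finset.sum_neg_distrib]
    linarith
  have hgreen : f (e a) - c =
      ∑ d, (negRestriction q e)⁻¹ a d * (negRestriction q e *ᵥ fun d => f (e d) - c) d := by
    have h := congrFun (Matrix.mulVec_mulVec (fun d => f (e d) - c) (negRestriction q e)⁻¹
      (negRestriction q e)) a
    rw [hA.inv_mul_self, Matrix.one_mulVec] at h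
    exact h.symm
  have hmono := Finset.sum_le_sum fun d (_ : d ∈ Finset.univ) =>
    mul_le_mul_of_nonneg_left (hle d) (hA.inv_nonneg a d)
  rw [← hgreen] at hmono
  simp only [mul_sub, Finset.sum_sub_distrib, ← Finset.sum_mul, mul_left_comm _ θ,
    ← Finset.mul_sum] at hmono
  linarith

end IsConservativeGenerator

end FiniteRestriction

section Hessenberg

variable {ι : Type*} [Fintype ι]

/-- Irreducible conservative generators on levels and phases whose blocks allow downward transitions
by one level only. -/
structure IsHessenbergGenerator (Q : ℕ → ℕ → Matrix ι ι ℝ) : Prop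
    extends IsConservativeGenerator (ofBlocks Q) where
  irreducible : IsIrreducibleGenerator (ofBlocks Q)
  eq_zero : ∀ k l, l + 1 < k → Q k l = 0

/-- The states of level at most `n`. -/
def levelEmbedding (ι : Type*) (n : ℕ) : Fin (n + 1) × ι ↪ ℕ × ι :=
  Fin.valEmbedding.prodMap (.refl ι)

omit [Fintype ι] in
theorem levelEmbedding_apply (n : ℕ) (x : Fin (n + 1) × ι) :
    levelEmbedding ι n x = ((x.1 : ℕ), x.2) := rfl

omit [Fintype ι] in
theorem mem_range_levelEmbedding {n : ℕ} {x : ℕ × ι} :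
    x ∈ Set.range (levelEmbedding ι n) ↔ x.1 ≤ n := by
  refine ⟨?_, fun hx => ⟨(⟨x.1, Nat.lt_succ_of_le hx⟩, x.2), rfl⟩⟩
  rintro ⟨y, rfl⟩
  exact Nat.lt_succ_iff.1 y.1.2

/-- The north-west corner of `-Q` formed by the levels up to `n`. -/
def truncation (Q : ℕ → ℕ → Matrix ι ι ℝ) (n : ℕ) :
    Matrix (Fin (n + 1) × ι) (Fin (n + 1) × ι) ℝ :=
  negRestriction (ofBlocks Q) (levelEmbedding ι n)

/-- The matrices `X 0, …, X n` placed side by side. -/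
def blockRow (X : ℕ → Matrix ι ι ℝ) (n : ℕ) : Matrix ι (Fin (n + 1) × ι) ℝ :=
  Matrix.of fun i x => X x.1 i x.2

theorem blockRow_mul_truncation (X : ℕ → Matrix ι ι ℝ) (Q : ℕ → ℕ → Matrix ι ι ℝ) (n : ℕ) (i : ι)
    (x : Fin (n + 1) × ι) : (blockRow X n * truncation Q n) i x =
      -(∑ k ∈ Finset.range (n + 1), X k * Q k x.1) i x.2 := by
  simp only [Matrix.mul_apply, blockRow, truncation, negRestriction_apply, Matrix.of_apply,
    levelEmbedding_apply, ofBlocks, mul_neg, Finset.sum_neg_distrib, Matrix.sum_apply,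
    Finset.sum_range, Fintype.sum_prod_type]

variable [DecidableEq ι] {Q : ℕ → ℕ → Matrix ι ι ℝ}

/-- The matrices `X_{n,k}` with `U*_{n,k} = U*_n X_{n,k}`: the part of the recursion for `U*` that
does not involve the inversion of the `n`-th pivot. -/
noncomputable def leftFactor (Q : ℕ → ℕ → Matrix ι ι ℝ) : ℕ → ℕ → Matrix ι ι ℝ
  | 0, k => if k = 0 then 1 else 0
  | n + 1, k => if k = n + 1 then 1 else Q (n + 1) n * Ustar Q n k

theorem leftFactor_self (Q : ℕ → ℕ → Matrix ι ι ℝ) (n : ℕ) : leftFactor Q n n = 1 := by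
  cases n <;> simp [leftFactor]

theorem Ustar_eq_zero_of_lt (Q : ℕ → ℕ → Matrix ι ι ℝ) {n k : ℕ} (h : n < k) :
    Ustar Q n k = 0 := by
  cases n with
  | zero => rw [Ustar, if_neg (by lia)]
  | succ n => rw [Ustar, if_neg (by lia), if_neg (by lia)]

theorem Ustar_eq_inv_pivot_mul (Q : ℕ → ℕ → Matrix ι ι ℝ) (n k : ℕ) :
    Ustar Q n k = (pivot Q n)⁻¹ * leftFactor Q n k := by
  cases n with
  | zero => simp only [Ustar, pivot, leftFactor, mul_ite, mul_one, mul_zero]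
  | succ n =>
    simp only [Ustar, pivot, leftFactor, mul_ite, mul_one, mul_assoc]
    split_ifs with h1 h2
    · rfl
    · rfl
    · rw [Ustar_eq_zero_of_lt Q (not_le.1 h2), mul_zero, mul_zero]

theorem sum_Ustar_mul_of_isUnit_pivot {n l : ℕ} (hu : IsUnit (pivot Q n))
    (h : ∑ k ∈ Finset.range (n + 1), leftFactor Q n k * Q k l = if l = n then -pivot Q n else 0) :
    ∑ k ∈ Finset.range (n + 1), Ustar Q n k * Q k l = if l = n then -1 else 0 := by
  simp only [Ustar_eq_inv_pivot_mul, mul_assoc]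
  rw [← Finset.mul_sum, h, mul_ite, mul_zero, mul_neg,
    Matrix.nonsing_inv_mul _ ((Matrix.isUnit_iff_isUnit_det _).1 hu)]

theorem uStar_eq_sum (Q : ℕ → ℕ → Matrix ι ι ℝ) (n : ℕ) :
    uStar Q n = ∑ k ∈ Finset.range (n + 1), Ustar Q n k *ᵥ fun _ => 1 := by
  induction n with
  | zero => simp [uStar]
  | succ n ih =>
    have hstep : ∀ k ∈ Finset.range (n + 1), Ustar Q (n + 1) k *ᵥ (fun _ => (1 : ℝ)) =
        Ustar Q (n + 1) (n + 1) *ᵥ Q (n + 1) n *ᵥ Ustar Q n k *ᵥ fun _ => 1 := by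
      intro k hk
      have hkn := Finset.mem_range.1 hk
      simp only [Ustar_eq_inv_pivot_mul Q (n + 1), leftFactor, if_neg hkn.ne, if_true, mul_one,
        Matrix.mulVec_mulVec]
    rw [Finset.sum_range_succ, Finset.sum_congr rfl hstep, uStar, ih, Matrix.mulVec_add,
      Matrix.mulVec_sum, Matrix.mulVec_sum, add_comm]

namespace IsHessenbergGenerator

omit [DecidableEq ι] in
theorem isWeaklyChainedDominant_truncation (hQ : IsHessenbergGenerator Q) (n : ℕ) :
    IsWeaklyChainedDominant (truncation Q n) := by
  rcases isEmpty_or_nonempty ι with _ | ⟨⟨i⟩⟩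
  · exact ⟨isEmptyElim, isEmptyElim, isEmptyElim⟩
  · exact hQ.isWeaklyChainedDominant_negRestriction hQ.irreducible (y := (n + 1, i))
      (mem_range_levelEmbedding.not.2 (Nat.lt_succ_self n).not_ge)

/- A left null vector of the pivot extends to one of the truncation. -/
theorem isUnit_pivot_of_sum_leftFactor_mul (hQ : IsHessenbergGenerator Q) {n : ℕ}
    (h : ∀ l ≤ n, ∑ k ∈ Finset.range (n + 1), leftFactor Q n k * Q k l =
      if l = n then -pivot Q n else 0) : IsUnit (pivot Q n) := by
  rw [← Matrix.vecMul_injective_iff_isUnit]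
  refine (injective_iff_map_eq_zero (Matrix.vecMulLinear (pivot Q n))).2 fun z hz => ?_
  rw [Matrix.vecMulLinear_apply] at hz
  have hrow : z ᵥ* (blockRow (leftFactor Q n) n * truncation Q n) = 0 := by
    funext x
    simp only [Matrix.vecMul, dotProduct, blockRow_mul_truncation,
      h x.1 (Nat.lt_succ_iff.1 x.1.2)]
    split_ifs
    · simpa [Matrix.vecMul, dotProduct] using congrFun hz x.2
    · simp
  have hzero : z ᵥ* blockRow (leftFactor Q n) n = 0 :=
    Matrix.vecMul_injective_iff_isUnit.2 (hQ.isWeaklyChainedDominant_truncation n).isUnit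
      (by simp only [Matrix.vecMul_vecMul, hrow, Matrix.zero_vecMul])
  funext i
  simpa [Matrix.vecMul, dotProduct, blockRow, leftFactor_self, Matrix.one_apply] using
    congrFun hzero (Fin.last n, i)

theorem sum_leftFactor_mul (hQ : IsHessenbergGenerator Q) {n l : ℕ} (hl : l ≤ n) :
    ∑ k ∈ Finset.range (n + 1), leftFactor Q n k * Q k l = if l = n then -pivot Q n else 0 := by
  induction n generalizing l with
  | zero => simp [Nat.le_zero.1 hl, leftFactor, pivot]
  | succ n ih =>
    have hstep : ∑ k ∈ Finset.range (n + 1 + 1), leftFactor Q (n + 1) k * Q k l =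
        Q (n + 1) l + Q (n + 1) n * ∑ k ∈ Finset.range (n + 1), Ustar Q n k * Q k l := by
      rw [Finset.sum_range_succ, leftFactor_self, one_mul, add_comm, Finset.mul_sum]
      congr 1
      refine Finset.sum_congr rfl fun k hk => ?_
      rw [leftFactor, if_neg (Finset.mem_range.1 hk).ne, mul_assoc]
    rw [hstep]
    rcases hl.eq_or_lt with rfl | hlt
    · rw [if_pos rfl, pivot, pivotOf, neg_sub, sub_neg_eq_add, add_comm]
    · have hln : l ≤ n := Nat.lt_succ_iff.1 hlt
      rw [sum_Ustar_mul_of_isUnit_pivot (hQ.isUnit_pivot_of_sum_leftFactor_mul fun _ h => ih h)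
        (ih hln), if_neg hlt.ne]
      rcases hln.eq_or_lt with rfl | hlt'
      · simp
      · simp [hlt'.ne, hQ.eq_zero (n + 1) l (by lia)]

theorem isUnit_pivot (hQ : IsHessenbergGenerator Q) (n : ℕ) : IsUnit (pivot Q n) :=
  hQ.isUnit_pivot_of_sum_leftFactor_mul fun _ h => hQ.sum_leftFactor_mul h

theorem inv_truncation_last (hQ : IsHessenbergGenerator Q) (n : ℕ) (i : ι)
    (x : Fin (n + 1) × ι) : (truncation Q n)⁻¹ (Fin.last n, i) x = Ustar Q n x.1 i x.2 := by
  have hT := (Matrix.isUnit_iff_isUnit_det _).1 (hQ.isWeaklyChainedDominant_truncation n).isUnit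
  have hmul : blockRow (Ustar Q n) n * truncation Q n =
      (1 : Matrix (Fin (n + 1) × ι) (Fin (n + 1) × ι) ℝ).submatrix (Prod.mk (Fin.last n)) id := by
    ext i ⟨l, j⟩
    have hl := Nat.lt_succ_iff.1 l.2
    rw [blockRow_mul_truncation,
      sum_Ustar_mul_of_isUnit_pivot (hQ.isUnit_pivot n) (hQ.sum_leftFactor_mul hl)]
    rcases eq_or_ne l (Fin.last n) with rfl | hne
    · simp [Matrix.one_apply]
    · have hne' : (l : ℕ) ≠ n := fun h => hne (Fin.ext h)
      simp [hne', hne.symm]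
  have hrow : blockRow (Ustar Q n) n =
      (truncation Q n)⁻¹.submatrix (Prod.mk (Fin.last n)) id := by
    rw [← Matrix.mul_nonsing_inv_cancel_right _ (blockRow (Ustar Q n) n) hT, hmul,
      ← Matrix.submatrix_id_id (truncation Q n)⁻¹, ← Matrix.submatrix_mul _ _ _ _ _
        Function.bijective_id, one_mul]
    simp
  exact (congrFun (congrFun hrow i) x).symm

theorem Ustar_nonneg (hQ : IsHessenbergGenerator Q) (n k : ℕ) (i j : ι) :
    0 ≤ Ustar Q n k i j := by
  rcases le_or_gt k n with hk | hk
  · have hinv := (hQ.isWeaklyChainedDominant_truncation n).inv_nonneg (Fin.last n, i)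
      (⟨k, Nat.lt_succ_of_le hk⟩, j)
    rwa [hQ.inv_truncation_last] at hinv
  · simp [Ustar_eq_zero_of_lt Q hk]

theorem uStar_eq_sum_inv_truncation (hQ : IsHessenbergGenerator Q) (n : ℕ) (i : ι) :
    uStar Q n i = ∑ x, (truncation Q n)⁻¹ (Fin.last n, i) x := by
  simp only [hQ.inv_truncation_last, Fintype.sum_prod_type, uStar_eq_sum, Finset.sum_apply,
    Finset.sum_range, Matrix.mulVec, dotProduct, mul_one]

theorem uStar_pos (hQ : IsHessenbergGenerator Q) (n : ℕ) (i : ι) :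
    0 < uStar Q n i :=
  hQ.uStar_eq_sum_inv_truncation n i ▸
    (hQ.isWeaklyChainedDominant_truncation n).sum_inv_pos (Fin.last n, i)

end IsHessenbergGenerator

end Hessenberg

section ProbabilityVectors

variable {S κ : Type*} {V : S → ℝ}

/- Scheffé's lemma: the positive part of `p - a n` is dominated by `p`, and it carries half of the
distance, as both vectors have the same mass. -/
theorem tendsto_tvDist_of_tendsto {l : Filter κ} {a : κ → S → ℝ} {p : S → ℝ}
    (ha0 : ∀ n x, 0 ≤ a n x) (ha : ∀ n, HasSum (a n) 1) (hp0 : ∀ x, 0 ≤ p x) (hp : HasSum p 1)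
    (hlim : Tendsto a l (𝓝 p)) : Tendsto (fun n => tvDist (a n) p) l (𝓝 0) := by
  have hdom (n : κ) (x : S) : ‖max (p x - a n x) 0‖ ≤ p x := by
    rw [Real.norm_of_nonneg (le_max_right _ _)]
    exact max_le (sub_le_self _ (ha0 n x)) (hp0 x)
  have hposPart : Tendsto (fun n => ∑' x, max (p x - a n x) 0) l (𝓝 (∑' _ : S, 0)) := by
    refine tendsto_tsum_of_dominated_convergence hp.summable (fun x => ?_) (.of_forall hdom)
    simpa only [sub_self, max_self] using
      ((tendsto_const_nhds (x := p x)).sub (tendsto_pi_nhds.1 hlim x)).max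
        (tendsto_const_nhds (x := (0 : ℝ)))
  have htvDist (n : κ) : tvDist (a n) p = 2 * ∑' x, max (p x - a n x) 0 := by
    have hs : Summable fun x => max (p x - a n x) 0 := .of_norm_bounded hp.summable (hdom n)
    have hsum := (hs.hasSum.mul_left 2).add ((ha n).sub hp)
    rw [sub_self, add_zero] at hsum
    rw [← hsum.tsum_eq, tvDist]
    refine tsum_congr fun x => ?_
    rcases le_total (p x) (a n x) with h | h
    · rw [abs_of_nonneg (sub_nonneg.2 h), max_eq_right (sub_nonpos.2 h)]
      ring
    · rw [abs_of_nonpos (sub_nonpos.2 h), max_eq_left (sub_nonneg.2 h)]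
      ring
  simp only [htvDist]
  simpa using hposPart.const_mul 2

theorem tvDist_le_tvDist_add_tvDist {a b c : S → ℝ} (ha : Summable a) (hb : Summable b)
    (hc : Summable c) : tvDist a b ≤ tvDist a c + tvDist b c := by
  have hac := (ha.sub hc).abs
  have hbc := (hb.sub hc).abs
  rw [tvDist, tvDist, tvDist, ← hac.tsum_add hbc]
  refine (ha.sub hb).abs.tsum_le_tsum (fun x => ?_) (hac.add hbc)
  simpa only [abs_sub_comm (c x) (b x)] using abs_sub_le (a x) (c x) (b x)

theorem exists_tendsto_of_ultrafilter {a : κ → S → ℝ} (ha0 : ∀ n x, 0 ≤ a n x)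
    (ha : ∀ n, HasSum (a n) 1) (l : Ultrafilter κ) : ∃ m, Tendsto a l (𝓝 m) := by
  have hmem (n : κ) : a n ∈ Set.univ.pi fun _ => Set.Icc (0 : ℝ) 1 := fun x _ =>
    ⟨ha0 n x, le_hasSum (ha n) x fun y _ => ha0 n y⟩
  obtain ⟨m, -, hm⟩ := (isCompact_univ_pi fun _ => isCompact_Icc).ultrafilter_le_nhds (l.map a)
    (le_principal_iff.2 (Filter.mem_map.2 (univ_mem' hmem)))
  exact ⟨m, hm⟩

/- Markov's inequality. -/
theorem one_sub_div_le_sum_of_le {a : S → ℝ} (ha0 : ∀ x, 0 ≤ a x) (ha : HasSum a 1)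
    (hV0 : ∀ x, 0 ≤ V x) (haV : Summable fun x => a x * V x) {R : ℝ} (hR : 0 < R) {s : Finset S}
    (hs : ∀ x ∉ s, R ≤ V x) : 1 - (∑' x, a x * V x) / R ≤ ∑ x ∈ s, a x := by
  classical
  have hfin : HasSum (fun x => if x ∈ s then a x else 0) (∑ x ∈ s, a x) := by
    rw [← Finset.sum_congr rfl fun x hx => if_pos (c := x ∈ s) (e := (0 : ℝ)) hx]
    exact hasSum_sum_of_ne_finset_zero fun x hx => if_neg hx
  have hle (x : S) : a x ≤ (if x ∈ s then a x else 0) + a x * V x / R := by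
    split_ifs with hx
    · exact le_add_of_nonneg_right (div_nonneg (mul_nonneg (ha0 x) (hV0 x)) hR.le)
    · rw [zero_add, le_div_iff₀ hR]
      exact mul_le_mul_of_nonneg_left (hs x hx) (ha0 x)
  exact sub_le_iff_le_add.2 (hasSum_le hle ha (hfin.add (haV.hasSum.div_const R)))

variable {l : Filter κ} [l.NeBot] {a : κ → S → ℝ} {m : S → ℝ} {B : ℝ}

theorem hasSum_one_of_tendsto (ha0 : ∀ n x, 0 ≤ a n x) (ha : ∀ n, HasSum (a n) 1)
    (hV0 : ∀ x, 0 ≤ V x) (hV : Tendsto V cofinite atTop)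
    (haV : ∀ n, Summable fun x => a n x * V x) (hB : ∀ n, ∑' x, a n x * V x ≤ B)
    (hlim : Tendsto a l (𝓝 m)) : HasSum m 1 := by
  have hlim' := tendsto_pi_nhds.1 hlim
  have hfin (s : Finset S) : Tendsto (fun n => ∑ x ∈ s, a n x) l (𝓝 (∑ x ∈ s, m x)) :=
    tendsto_finsetSum s fun x _ => hlim' x
  have hm0 (x : S) : 0 ≤ m x := ge_of_tendsto' (hlim' x) fun n => ha0 n x
  refine hasSum_of_isLUB_of_nonneg 1 hm0 ⟨?_, fun M hM => ?_⟩
  · rintro _ ⟨s, rfl⟩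
    exact le_of_tendsto' (hfin s) fun n => sum_le_hasSum s (fun x _ => ha0 n x) (ha n)
  · have htail : Tendsto (fun R => 1 - B / R) atTop (𝓝 1) := by
      simpa using (tendsto_const_nhds (x := (1 : ℝ))).sub
        ((tendsto_const_nhds (x := B)).div_atTop tendsto_id)
    refine le_of_tendsto htail ((eventually_gt_atTop 0).mono fun R hR => ?_)
    have hfinite : {x | ¬ R ≤ V x}.Finite := hV.eventually_ge_atTop R
    refine le_trans (ge_of_tendsto' (hfin hfinite.toFinset) fun n => ?_) (hM ⟨_, rfl⟩)
    have hmarkov := one_sub_div_le_sum_of_le (ha0 n) (ha n) hV0 (haV n) hR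
      (s := hfinite.toFinset) (by simp)
    exact (sub_le_sub_left (div_le_div_of_nonneg_right (hB n) hR.le) 1).trans hmarkov

theorem summable_mul_of_tendsto (ha0 : ∀ n x, 0 ≤ a n x) (hV0 : ∀ x, 0 ≤ V x)
    (haV : ∀ n, Summable fun x => a n x * V x) (hB : ∀ n, ∑' x, a n x * V x ≤ B)
    (hlim : Tendsto a l (𝓝 m)) : Summable fun x => m x * V x := by
  have hlim' := tendsto_pi_nhds.1 hlim
  have hm0 (x : S) : 0 ≤ m x := ge_of_tendsto' (hlim' x) fun n => ha0 n x
  refine summable_of_sum_le (c := B) (fun x => mul_nonneg (hm0 x) (hV0 x)) fun s => ?_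
  refine le_of_tendsto' (tendsto_finsetSum s fun x _ => (hlim' x).mul_const (V x)) fun n => ?_
  exact ((haV n).sum_le_tsum s fun x _ => mul_nonneg (ha0 n x) (hV0 x)).trans (hB n)

end ProbabilityVectors

section Approximation

variable {ι : Type*}

/-- Foster-Lyapunov functions of the level that satisfy `Q V ≤ -θ V + b` and have finite sublevel
sets. -/
structure IsLevelLyapunov (Q : ℕ → ℕ → Matrix ι ι ℝ) (V : ℕ → ℝ) (θ b : ℝ) : Prop where
  rate_pos : 0 < θ
  nonneg : ∀ k, 0 ≤ V k
  monotone : Monotone V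
  tendsto_atTop : Tendsto V atTop atTop
  summable : ∀ x, Summable fun y : ℕ × ι => ofBlocks Q x y * V y.1
  drift : ∀ x, ∑' y : ℕ × ι, ofBlocks Q x y * V y.1 ≤ -θ * V x.1 + b

theorem IsLevelLyapunov.tendsto_cofinite [Finite ι] {Q : ℕ → ℕ → Matrix ι ι ℝ} {V : ℕ → ℝ} {θ b : ℝ}
    (hV : IsLevelLyapunov Q V θ b) : Tendsto (fun x : ℕ × ι => V x.1) cofinite atTop := by
  refine hV.tendsto_atTop.comp (Nat.cofinite_eq_atTop ▸ ?_)
  refine Tendsto.cofinite_of_finite_preimage_singleton fun k => ?_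
  exact ((Set.finite_singleton k).prod Set.finite_univ).subset fun x hx => ⟨hx, trivial⟩

theorem hasSum_mulVec_level [Fintype ι] {Q : ℕ → ℕ → Matrix ι ι ℝ} {v : ℕ × ι → ℝ} {k : ℕ} {i : ι}
    (hv : Summable fun y => ofBlocks Q (k, i) y * v y) :
    HasSum (fun l => (Q k l *ᵥ fun j => v (l, j)) i) (∑' y, ofBlocks Q (k, i) y * v y) :=
  hv.hasSum.prod_fiberwise fun _ => hasSum_fintype _

theorem summable_tailTerm [Fintype ι] {Q : ℕ → ℕ → Matrix ι ι ℝ} {v : ℕ × ι → ℝ} {k : ℕ} {i : ι}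
    (hv : Summable fun y => ofBlocks Q (k, i) y * v y) (n : ℕ) :
    Summable fun m => tailTerm Q v n k m i := by
  refine ((summable_nat_add_iff (n + 1)).2 (hasSum_mulVec_level hv).summable).congr fun m => ?_
  rw [tailTerm, add_comm m]

theorem IsLevelLyapunov.exists_drift [Fintype ι] {Q : ℕ → ℕ → Matrix ι ι ℝ} {V : ℕ → ℝ} {θ b : ℝ}
    (hV : IsLevelLyapunov Q V θ b) :
    ∃ K, ∃ ρ : ℝ, 0 < ρ ∧ ∀ k, K + 1 ≤ k → ∀ i,
      Summable (fun l => (Q k l *ᵥ fun _ => V l) i) ∧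
      ∑' l, (Q k l *ᵥ fun _ => V l) i ≤ -ρ * V k ∧ -ρ * V k ≤ -1 := by
  have hρ := half_pos hV.rate_pos
  obtain ⟨K, hK⟩ := eventually_atTop.1
    (((hV.tendsto_atTop.const_mul_atTop hρ).eventually_ge_atTop (max b 1)))
  refine ⟨K, θ / 2, hρ, fun k hk i => ?_⟩
  have hrow := hasSum_mulVec_level (hV.summable (k, i))
  have hlarge := max_le_iff.1 (hK k (K.le_succ.trans hk))
  have hdrift := hV.drift (k, i)
  rw [← hrow.tsum_eq] at hdrift
  exact ⟨hrow.summable, by linarith, by linarith⟩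

variable [Fintype ι] [DecidableEq ι] {Q : ℕ → ℕ → Matrix ι ι ℝ}

namespace IsHessenbergGenerator

theorem approx_nonneg (hQ : IsHessenbergGenerator Q) (j : ℕ → ι) (n : ℕ) (x : ℕ × ι) :
    0 ≤ approx Q j n x := by
  unfold approx
  split_ifs
  · exact div_nonneg (hQ.Ustar_nonneg _ _ _ _) (hQ.uStar_pos _ _).le
  · exact le_rfl

theorem hasSum_approx_mul (hQ : IsHessenbergGenerator Q) (j : ℕ → ι) (n : ℕ) (f : ℕ × ι → ℝ) :
    HasSum (fun x => approx Q j n x * f x)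
      ((∑ x, (truncation Q n)⁻¹ (Fin.last n, j n) x * f (levelEmbedding ι n x)) /
        uStar Q n (j n)) := by
  rw [← (levelEmbedding ι n).injective.hasSum_iff, Finset.sum_div]
  · convert hasSum_fintype _ using 2 with x
    rw [Function.comp_apply, approx, if_pos (mem_range_levelEmbedding.1 ⟨x, rfl⟩),
      levelEmbedding_apply, hQ.inv_truncation_last, div_mul_eq_mul_div]
  · intro x hx
    rw [approx, if_neg (mem_range_levelEmbedding.not.1 hx), zero_mul]

theorem hasSum_approx (hQ : IsHessenbergGenerator Q) (j : ℕ → ι) (n : ℕ) :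
    HasSum (approx Q j n) 1 := by
  have hsum := hQ.hasSum_approx_mul j n fun _ => 1
  simp only [mul_one, ← hQ.uStar_eq_sum_inv_truncation, div_self (hQ.uStar_pos n (j n)).ne'] at hsum
  exact hsum

theorem hasSum_approx_mul_ofBlocks (hQ : IsHessenbergGenerator Q) (j : ℕ → ι) {n : ℕ}
    {y : ℕ × ι} (hy : y.1 < n) : HasSum (fun x => approx Q j n x * ofBlocks Q x y) 0 := by
  obtain ⟨y, rfl⟩ := mem_range_levelEmbedding.2 hy.le
  have hyn : y ≠ (Fin.last n, j n) := by
    rintro rfl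
    exact lt_irrefl n hy
  have hinv := congrFun (congrFun (hQ.isWeaklyChainedDominant_truncation n).inv_mul_self
    (Fin.last n, j n)) y
  rw [Matrix.mul_apply, Matrix.one_apply_ne hyn.symm] at hinv
  simp only [truncation, negRestriction_apply, mul_neg, Finset.sum_neg_distrib,
    neg_eq_zero] at hinv
  simpa only [truncation, hinv, zero_div] using hQ.hasSum_approx_mul j n fun x =>
    ofBlocks Q x (levelEmbedding ι n y)

theorem tsum_approx_mul_le (hQ : IsHessenbergGenerator Q) {V : ℕ → ℝ} {θ b : ℝ}
    (hV : IsLevelLyapunov Q V θ b) (j : ℕ → ι) (n : ℕ) :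
    ∑' x, approx Q j n x * V x.1 ≤ b / θ := by
  rw [(hQ.hasSum_approx_mul j n fun x => V x.1).tsum_eq,
    div_le_div_iff₀ (hQ.uStar_pos n _) hV.rate_pos, hQ.uStar_eq_sum_inv_truncation]
  have hgreen := hQ.green_mul_le_of_drift (hQ.isWeaklyChainedDominant_truncation n)
    (f := fun x => V x.1) (c := V n)
    (fun x hx => hV.monotone (not_le.1 (mem_range_levelEmbedding.not.1 hx)).le)
    (fun _ => hV.summable _) (fun _ => hV.drift _) (Fin.last n, j n)
  simp only [levelEmbedding_apply, Fin.val_last, sub_self, add_zero] at hgreen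
  rwa [mul_comm] at hgreen

theorem balance_of_tendsto_approx (hQ : IsHessenbergGenerator Q) {l : Filter ℕ} [l.NeBot]
    (hl : l ≤ atTop) {j : ℕ → ι} {m : ℕ × ι → ℝ} (hlim : Tendsto (approx Q j) l (𝓝 m))
    (y : ℕ × ι) : HasSum (fun x => m x * ofBlocks Q x y) 0 := by
  have hzero : ∀ x ∉ Finset.range (y.1 + 2) ×ˢ (Finset.univ : Finset ι), ofBlocks Q x y = 0 := by
    intro x hx
    have hx' : y.1 + 2 ≤ x.1 := by simpa using hx
    rw [ofBlocks, hQ.eq_zero _ _ hx', Matrix.zero_apply]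
  have hfin (a : ℕ × ι → ℝ) : HasSum (fun x => a x * ofBlocks Q x y)
      (∑ x ∈ Finset.range (y.1 + 2) ×ˢ Finset.univ, a x * ofBlocks Q x y) :=
    hasSum_sum_of_ne_finset_zero fun x hx => by rw [hzero x hx, mul_zero]
  have hbalance : ∀ᶠ n in l,
      ∑ x ∈ Finset.range (y.1 + 2) ×ˢ Finset.univ, approx Q j n x * ofBlocks Q x y = 0 :=
    hl ((eventually_gt_atTop y.1).mono fun n hn =>
      (hfin _).unique (hQ.hasSum_approx_mul_ofBlocks j hn))
  have hsum := tendsto_finsetSum (Finset.range (y.1 + 2) ×ˢ (Finset.univ : Finset ι)) fun x _ =>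
    (tendsto_pi_nhds.1 hlim x).mul_const (ofBlocks Q x y)
  rw [← tendsto_nhds_unique hsum ((tendsto_congr' hbalance).2 tendsto_const_nhds)]
  exact hfin m

theorem exists_tendsto_approx (hQ : IsHessenbergGenerator Q) {V : ℕ → ℝ} {θ b : ℝ}
    (hV : IsLevelLyapunov Q V θ b) (j : ℕ → ι) {l : Ultrafilter ℕ} (hl : (l : Filter ℕ) ≤ atTop) :
    ∃ m, Tendsto (approx Q j) l (𝓝 m) ∧ IsStationaryDistribution (ofBlocks Q) m ∧
      Summable fun x => m x * V x.1 := by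
  obtain ⟨m, hm⟩ := exists_tendsto_of_ultrafilter (hQ.approx_nonneg j) (hQ.hasSum_approx j) l
  have hsummable (n : ℕ) := (hQ.hasSum_approx_mul j n fun x => V x.1).summable
  exact ⟨m, hm,
    ⟨fun x => ge_of_tendsto' (tendsto_pi_nhds.1 hm x) fun n => hQ.approx_nonneg j n x,
      hasSum_one_of_tendsto (hQ.approx_nonneg j) (hQ.hasSum_approx j) (fun x => hV.nonneg x.1)
        hV.tendsto_cofinite hsummable (hQ.tsum_approx_mul_le hV j) hm,
      hQ.balance_of_tendsto_approx hl hm⟩,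
    summable_mul_of_tendsto (hQ.approx_nonneg j) (fun x => hV.nonneg x.1) hsummable
      (hQ.tsum_approx_mul_le hV j) hm⟩

omit [Fintype ι] [DecidableEq ι] in
theorem exists_isStationaryDistribution [Finite ι] [Nonempty ι] (hQ : IsHessenbergGenerator Q)
    {V : ℕ → ℝ} {θ b : ℝ} (hV : IsLevelLyapunov Q V θ b) :
    ∃ p, IsStationaryDistribution (ofBlocks Q) p ∧ Summable fun x => p x * V x.1 := by
  classical
  have := Fintype.ofFinite ι
  obtain ⟨p, -, hp⟩ := hQ.exists_tendsto_approx hV (fun _ => Classical.arbitrary ι)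
    Nat.hyperfilter_le_atTop
  exact ⟨p, hp⟩

omit [Fintype ι] [DecidableEq ι] in
theorem isStationaryDistribution_unique_of_rate_le (hQ : IsHessenbergGenerator Q) {V : ℕ → ℝ}
    {a : ℝ} (ha : ∀ x, |ofBlocks Q x x| ≤ a * V x.1) {p r : ℕ × ι → ℝ}
    (hp : IsStationaryDistribution (ofBlocks Q) p) (hpV : Summable fun x => p x * V x.1)
    (hr : IsStationaryDistribution (ofBlocks Q) r) : r = p := by
  refine hQ.isStationaryDistribution_unique hQ.irreducible hp hr
    (Summable.of_nonneg_of_le (fun x => mul_nonneg (hp.nonneg x) (abs_nonneg _)) (fun x => ?_)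
      (hpV.mul_left a))
  rw [mul_left_comm]
  exact mul_le_mul_of_nonneg_left (ha x) (hp.nonneg x)

theorem tendsto_tvDist_approx (hQ : IsHessenbergGenerator Q) {V : ℕ → ℝ} {θ b a : ℝ}
    (hV : IsLevelLyapunov Q V θ b) (ha : ∀ x, |ofBlocks Q x x| ≤ a * V x.1) {p : ℕ × ι → ℝ}
    (hp : IsStationaryDistribution (ofBlocks Q) p) (j : ℕ → ι) :
    Tendsto (fun n => tvDist (approx Q j n) p) atTop (𝓝 0) := by
  refine tendsto_tvDist_of_tendsto (hQ.approx_nonneg j) (hQ.hasSum_approx j) hp.nonneg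
    hp.hasSum_one ((tendsto_iff_ultrafilter _ _ _).2 fun l hl => ?_)
  obtain ⟨m, hlim, hm, hmV⟩ := hQ.exists_tendsto_approx hV j hl
  exact hQ.isStationaryDistribution_unique_of_rate_le ha hm hmV hp ▸ hlim

theorem yVec_pos (hQ : IsHessenbergGenerator Q) {v : ℕ × ι → ℝ} (hv : ∀ x, 0 < v x) (n : ℕ)
    (i : ι) : 0 < yVec Q v n i := by
  refine add_pos_of_pos_of_nonneg (hv _) (Finset.sum_nonneg fun k hk => ?_)
  refine dotProduct_nonneg_of_nonneg (hQ.Ustar_nonneg n k i) fun a => tsum_nonneg fun m => ?_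
  have hkn := Finset.mem_range.1 hk
  exact dotProduct_nonneg_of_nonneg
    (fun b => hQ.offDiag_nonneg (k, a) (n + 1 + m, b) fun h => by lia) fun b => (hv _).le

theorem exists_tvDist_approx_lt (hQ : IsHessenbergGenerator Q) {p : ℕ × ι → ℝ} {j : ℕ → ι}
    (hp : Summable p) (hlim : Tendsto (fun n => tvDist (approx Q j n) p) atTop (𝓝 0)) {ε : ℝ}
    (hε : 0 < ε) {N : ℕ → ℕ} (hN : StrictMono N) :
    ∃ l, 1 ≤ l ∧ tvDist (approx Q j (N l)) (approx Q j (N (l - 1))) < ε := by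
  obtain ⟨L, hL⟩ := eventually_atTop.1
    ((hlim.comp hN.tendsto_atTop).eventually (gt_mem_nhds (half_pos hε)))
  refine ⟨L + 1, L.succ_pos, ?_⟩
  calc tvDist (approx Q j (N (L + 1))) (approx Q j (N L))
      ≤ tvDist (approx Q j (N (L + 1))) p + tvDist (approx Q j (N L)) p :=
        tvDist_le_tvDist_add_tvDist (hQ.hasSum_approx j _).summable
          (hQ.hasSum_approx j _).summable hp
    _ < ε / 2 + ε / 2 := add_lt_add (hL (L + 1) L.le_succ) (hL L le_rfl)
    _ = ε := add_halves ε

theorem algorithmApplies (hQ : IsHessenbergGenerator Q) {v p : ℕ × ι → ℝ} (hv : ∀ x, 0 < v x)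
    (hQv : ∀ x, Summable fun y => ofBlocks Q x y * v y) (hp : Summable p)
    (hlim : ∀ j, Tendsto (fun n => tvDist (approx Q j n) p) atTop (𝓝 0)) :
    AlgorithmApplies Q v p where
  isUnit_pivot := hQ.isUnit_pivot
  uStar_pos := hQ.uStar_pos
  tail_summable n k i _ := summable_tailTerm (hQv (k, i)) n
  yVec_pos := hQ.yVec_pos hv
  approx_nonneg j _ := hQ.approx_nonneg j
  approx_hasSum j _ := hQ.hasSum_approx j
  converges j _ := hlim j
  terminates j _ _ hε _ _ hN _ := hQ.exists_tvDist_approx_lt hp (hlim j) hε hN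

end IsHessenbergGenerator

end Approximation

section Logarithms

/-- The shifted logarithm `log (x + e)`, which is at least `1` for `x ≥ 0` and is the logarithmic
factor of `lyapV`. -/
noncomputable def logShift (x : ℝ) : ℝ := Real.log (x + Real.exp 1)

variable {x y m : ℝ}

theorem one_le_logShift (hx : 0 ≤ x) : 1 ≤ logShift x :=
  (Real.le_log_iff_exp_le (by positivity)).2 (le_add_of_nonneg_left hx)

theorem logShift_le_logShift (hx : 0 ≤ x) (hxy : x ≤ y) : logShift x ≤ logShift y :=
  Real.log_le_log (by positivity) (by linarith)

theorem one_le_add_exp_one (hx : 0 ≤ x) : 1 ≤ x + Real.exp 1 := by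
  linarith [Real.exp_one_gt_two]

theorem logShift_le_lyapV (hx : 0 ≤ x) : logShift x ≤ lyapV x :=
  le_mul_of_one_le_left (zero_le_one.trans (one_le_logShift hx)) (one_le_add_exp_one hx)

theorem add_exp_one_le_lyapV (hx : 0 ≤ x) : x + Real.exp 1 ≤ lyapV x :=
  le_mul_of_one_le_right (zero_le_one.trans (one_le_add_exp_one hx)) (one_le_logShift hx)

theorem self_le_lyapV (hx : 0 ≤ x) : x ≤ lyapV x :=
  (le_add_of_nonneg_right (Real.exp_pos 1).le).trans (add_exp_one_le_lyapV hx)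

theorem lyapV_nonneg (hx : 0 ≤ x) : 0 ≤ lyapV x :=
  hx.trans (self_le_lyapV hx)

theorem lyapV_le_lyapV (hx : 0 ≤ x) (hxy : x ≤ y) : lyapV x ≤ lyapV y :=
  mul_le_mul (by linarith) (logShift_le_logShift hx hxy) (zero_le_one.trans (one_le_logShift hx))
    (zero_le_one.trans (one_le_add_exp_one (hx.trans hxy)))

theorem logShift_add_sub_le (hx : 0 ≤ x) (hm : 0 ≤ m) :
    logShift (x + m) - logShift x ≤ m / (x + Real.exp 1) := by
  have hx' : 0 < x + Real.exp 1 := by positivity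
  have hxm : 0 < x + m + Real.exp 1 := by positivity
  rw [logShift, logShift, ← Real.log_div hxm.ne' hx'.ne']
  refine (Real.log_le_sub_one_of_pos (div_pos hxm hx')).trans_eq ?_
  field_simp
  ring

theorem one_div_le_logShift_sub (hx : 0 ≤ x) :
    1 / (x + 1 + Real.exp 1) ≤ logShift (x + 1) - logShift x := by
  have hx' : 0 < x + Real.exp 1 := by positivity
  have hx1 : 0 < x + 1 + Real.exp 1 := by positivity
  have hlog := Real.log_le_sub_one_of_pos (div_pos hx' hx1)
  rw [Real.log_div hx'.ne' hx1.ne', ← logShift, ← logShift] at hlog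
  have hdiv : (x + Real.exp 1) / (x + 1 + Real.exp 1) - 1 = -(1 / (x + 1 + Real.exp 1)) := by
    field_simp
    ring
  linarith

theorem logShift_add_le (hx : 0 ≤ x) (hm : 0 ≤ m) :
    logShift (x + m) ≤ logShift x + logShift m := by
  have hx' := one_le_add_exp_one hx
  have hm' := one_le_add_exp_one hm
  rw [logShift, logShift, logShift, ← Real.log_mul (by positivity) (by positivity)]
  refine Real.log_le_log (by positivity) ?_
  nlinarith [mul_nonneg hx hm, Real.exp_one_gt_two]

theorem lyapV_add_sub_le (hx : 0 ≤ x) (hm : 0 ≤ m) :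
    lyapV (x + m) - lyapV x ≤ 3 * logShift x * lyapV m := by
  have hlog := logShift_add_sub_le hx hm
  rw [le_div_iff₀ (by positivity)] at hlog
  have hLx := one_le_logShift hx
  have hLm := one_le_logShift hm
  have hmV := self_le_lyapV hm
  have hmL : m * logShift m ≤ lyapV m :=
    mul_le_mul_of_nonneg_right (le_add_of_nonneg_right (Real.exp_pos 1).le) (zero_le_one.trans hLm)
  have hV : lyapV m ≤ logShift x * lyapV m := le_mul_of_one_le_left (hm.trans hmV) hLx
  calc lyapV (x + m) - lyapV x
      = (logShift (x + m) - logShift x) * (x + Real.exp 1) + m * logShift (x + m) := by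
        simp only [lyapV, logShift]
        ring
    _ ≤ m + m * (logShift x + logShift m) :=
        add_le_add hlog (mul_le_mul_of_nonneg_left (logShift_add_le hx hm) hm)
    _ ≤ 3 * logShift x * lyapV m := by
        linarith [mul_le_mul_of_nonneg_left hmV (zero_le_one.trans hLx)]

theorem logShift_le_lyapV_sub (hx : 0 ≤ x) :
    logShift (x + 1) ≤ lyapV (x + 1) - lyapV x := by
  have hlog := mul_le_mul_of_nonneg_left
    (logShift_le_logShift hx (le_add_of_nonneg_right zero_le_one))
    (zero_le_one.trans (one_le_add_exp_one hx))
  simp only [lyapV, logShift] at hlog ⊢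
  linarith

theorem sub_mul_logShift_le {A a : ℝ} (hA : 0 ≤ A) (ha : 0 < a) (hx : 0 ≤ x) :
    (A - a * x) * logShift x ≤ A * logShift (A / a) := by
  have hLx := zero_le_one.trans (one_le_logShift hx)
  rcases le_total x (A / a) with h | h
  · exact mul_le_mul (sub_le_self _ (mul_nonneg ha.le hx)) (logShift_le_logShift hx h) hLx hA
  · have hL := zero_le_one.trans (one_le_logShift (div_nonneg hA ha.le))
    rw [div_le_iff₀' ha] at h
    exact (mul_nonpos_of_nonpos_of_nonneg (sub_nonpos.2 h) hLx).trans (mul_nonneg hA hL)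

theorem lyapV_increment_nonneg (k m : ℕ) :
    0 ≤ lyapV ((k + (m + 1) : ℕ) : ℝ) - lyapV k :=
  sub_nonneg.2 (lyapV_le_lyapV k.cast_nonneg (Nat.cast_le.2 (Nat.le_add_right _ _)))

theorem lyapV_increment_le (k m : ℕ) :
    lyapV ((k + (m + 1) : ℕ) : ℝ) - lyapV k ≤ 3 * logShift k * lyapV ((m + 1 : ℕ) : ℝ) := by
  rw [Nat.cast_add]
  exact lyapV_add_sub_le k.cast_nonneg (Nat.cast_nonneg _)

theorem logShift_increment_nonneg (k m : ℕ) :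
    0 ≤ logShift ((k + (m + 1) : ℕ) : ℝ) - logShift k :=
  sub_nonneg.2 (logShift_le_logShift k.cast_nonneg (Nat.cast_le.2 (Nat.le_add_right _ _)))

theorem logShift_increment_le (k m : ℕ) :
    logShift ((k + (m + 1) : ℕ) : ℝ) - logShift k ≤
      1 / (k + Real.exp 1) * lyapV ((m + 1 : ℕ) : ℝ) := by
  rw [Nat.cast_add, one_div_mul_eq_div]
  exact (logShift_add_sub_le k.cast_nonneg (Nat.cast_nonneg _)).trans
    (div_le_div_of_nonneg_right (self_le_lyapV (Nat.cast_nonneg _)) (by positivity))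

end Logarithms

section Queue

section Blocks

variable {ι : Type*} [DecidableEq ι] {D : ℕ → Matrix ι ι ℝ} {μ : ℝ}

theorem bmapBlocks_self (k : ℕ) :
    bmapBlocks D μ k k = D 0 - ((k : ℝ) * μ) • (1 : Matrix ι ι ℝ) := by
  simp [bmapBlocks]

theorem bmapBlocks_add_succ (k m : ℕ) : bmapBlocks D μ k (k + (m + 1)) = D (m + 1) := by
  simp [bmapBlocks]

theorem bmapBlocks_succ_self (k : ℕ) :
    bmapBlocks D μ (k + 1) k = (((k + 1 : ℕ) : ℝ) * μ) • (1 : Matrix ι ι ℝ) := by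
  simp [bmapBlocks]

theorem bmapBlocks_of_succ_lt {k l : ℕ} (h : l + 1 < k) : bmapBlocks D μ k l = 0 := by
  rw [bmapBlocks, if_neg (by lia), if_neg (by lia), if_neg (by lia)]

theorem ofBlocks_bmapBlocks_add {m k : ℕ} {i j : ι} (h : (k, i) ≠ (k + m, j)) :
    ofBlocks (bmapBlocks D μ) (k, i) (k + m, j) = D m i j := by
  cases m with
  | zero =>
    have hij : i ≠ j := fun hij => h (by rw [hij, add_zero])
    simp [ofBlocks, bmapBlocks_self, hij]
  | succ m => rw [ofBlocks, bmapBlocks_add_succ]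

theorem abs_ofBlocks_bmapBlocks_self_le [Fintype ι] (hμ : 0 ≤ μ) (x : ℕ × ι) :
    |ofBlocks (bmapBlocks D μ) x x| ≤ (∑ i, |D 0 i i| + μ) * (x.1 + Real.exp 1) := by
  have hdiag : ofBlocks (bmapBlocks D μ) x x = D 0 x.2 x.2 - x.1 * μ := by
    simp [ofBlocks, bmapBlocks_self]
  have hle : |D 0 x.2 x.2| ≤ ∑ i, |D 0 i i| :=
    Finset.single_le_sum (f := fun i => |D 0 i i|) (fun _ _ => abs_nonneg _) (Finset.mem_univ x.2)
  calc |ofBlocks (bmapBlocks D μ) x x| ≤ |D 0 x.2 x.2| + x.1 * μ := by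
        rw [hdiag]
        exact (abs_sub _ _).trans_eq (by rw [abs_of_nonneg (a := x.1 * μ) (by positivity)])
    _ ≤ (∑ i, |D 0 i i|) * (x.1 + Real.exp 1) + μ * (x.1 + Real.exp 1) := by
        refine add_le_add (hle.trans ?_) ?_
        · exact le_mul_of_one_le_right ((abs_nonneg _).trans hle)
            (one_le_add_exp_one x.1.cast_nonneg)
        · rw [mul_comm]
          exact mul_le_mul_of_nonneg_left (le_add_of_nonneg_right (Real.exp_pos 1).le) hμ
    _ = (∑ i, |D 0 i i| + μ) * (x.1 + Real.exp 1) := (add_mul _ _ _).symm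

end Blocks

section Arrivals

variable {ι : Type*} [Fintype ι]

/-- The total rate at which batches of size `m + 1` arrive in phase `i`. -/
noncomputable def batchRate (D : ℕ → Matrix ι ι ℝ) (m : ℕ) (i : ι) : ℝ :=
  (D (m + 1) *ᵥ fun _ => 1) i

/-- The drift of the function `f` of the level in phase `i` on level `k`; on level `0` the departure
term vanishes together with its rate `k * μ`. -/
noncomputable def levelDrift (D : ℕ → Matrix ι ι ℝ) (μ : ℝ) (f : ℕ → ℝ) (k : ℕ) (i : ι) : ℝ :=
  k * μ * (f (k - 1) - f k) + ∑' m, batchRate D m i * (f (k + (m + 1)) - f k)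

theorem mulVec_const_apply (A : Matrix ι ι ℝ) (c : ℝ) (i : ι) :
    (A *ᵥ fun _ => c) i = (A *ᵥ fun _ => 1) i * c := by
  simp only [Matrix.mulVec, dotProduct, Finset.sum_mul, mul_one]

variable {D : ℕ → Matrix ι ι ℝ} {μ : ℝ}

theorem sum_range_bmapBlocks [DecidableEq ι] (f : ℕ → ℝ) (k : ℕ) (i : ι) :
    ∑ l ∈ Finset.range (k + 1), (bmapBlocks D μ k l *ᵥ fun _ => f l) i =
      k * μ * (f (k - 1) - f k) + (D 0 *ᵥ fun _ => 1) i * f k := by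
  have hself : (bmapBlocks D μ k k *ᵥ fun _ => f k) i =
      (D 0 *ᵥ fun _ => 1) i * f k - k * μ * f k := by
    rw [bmapBlocks_self, Matrix.sub_mulVec, Matrix.smul_mulVec, Matrix.one_mulVec,
      Pi.sub_apply, mulVec_const_apply, Pi.smul_apply, smul_eq_mul]
  rw [Finset.sum_range_succ, hself]
  cases k with
  | zero => simp
  | succ k =>
    have hbelow : ∀ l ∈ Finset.range k, (bmapBlocks D μ (k + 1) l *ᵥ fun _ => f l) i = 0 := by
      intro l hl
      rw [bmapBlocks_of_succ_lt (Nat.succ_lt_succ (Finset.mem_range.1 hl)), Matrix.zero_mulVec,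
        Pi.zero_apply]
    rw [Finset.sum_range_succ, Finset.sum_eq_zero hbelow, bmapBlocks_succ_self,
      Matrix.smul_mulVec, Matrix.one_mulVec, Pi.smul_apply, smul_eq_mul, Nat.add_sub_cancel]
    ring

namespace IsBMAP

theorem batchRate_nonneg (hD : IsBMAP D) (m : ℕ) (i : ι) : 0 ≤ batchRate D m i :=
  dotProduct_nonneg_of_nonneg (hD.nonneg _ m.succ_pos i) fun _ => zero_le_one

theorem hasSum_batchRate (hD : IsBMAP D) (i : ι) :
    HasSum (fun m => batchRate D m i) (-(D 0 *ᵥ fun _ => 1) i) := by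
  have hsum : HasSum (fun m => (D m *ᵥ fun _ => 1) i) 0 := by
    simpa only [hD.conservative i, Matrix.mulVec, dotProduct, mul_one] using
      hasSum_sum (s := Finset.univ) fun j _ => (hD.summable i j).hasSum
  simpa [batchRate] using (hasSum_nat_add_iff' 1).2 hsum

variable [DecidableEq ι]

theorem hasSum_bmapBlocks_mulVec (hD : IsBMAP D) {f : ℕ → ℝ} {k : ℕ} {i : ι}
    (hf : Summable fun m => batchRate D m i * f (k + (m + 1))) :
    HasSum (fun l => (bmapBlocks D μ k l *ᵥ fun _ => f l) i) (levelDrift D μ f k i) := by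
  have hshift := (hf.hasSum.sub ((hD.hasSum_batchRate i).mul_right (f k))).tsum_eq
  simp only [← mul_sub] at hshift
  have hterm (m : ℕ) : (bmapBlocks D μ k (m + (k + 1)) *ᵥ fun _ => f (m + (k + 1))) i =
      batchRate D m i * f (k + (m + 1)) := by
    rw [show m + (k + 1) = k + (m + 1) by ring, bmapBlocks_add_succ, mulVec_const_apply, batchRate]
  rw [← hasSum_nat_add_iff' (k + 1), sum_range_bmapBlocks, levelDrift, hshift,
    add_sub_add_left_eq_sub, neg_mul, sub_neg_eq_add, add_sub_cancel_right]
  simpa only [hterm] using hf.hasSum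

theorem summable_ofBlocks_mul (hD : IsBMAP D) {f : ℕ → ℝ} {k : ℕ} {i : ι}
    (hf : Summable fun m => batchRate D m i * f (k + (m + 1))) :
    Summable fun y => ofBlocks (bmapBlocks D μ) (k, i) y * f y.1 := by
  refine Summable.of_abs ((summable_prod_of_nonneg fun _ => abs_nonneg _).2
    ⟨fun _ => Summable.of_finite, (summable_nat_add_iff (k + 1)).1 (hf.abs.congr fun m => ?_)⟩)
  simp only [tsum_fintype, ofBlocks, show m + (k + 1) = k + (m + 1) by ring, bmapBlocks_add_succ,
    abs_mul, ← Finset.sum_mul, abs_of_nonneg (hD.batchRate_nonneg m i),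
    abs_of_nonneg (hD.nonneg (m + 1) m.succ_pos i _)]
  simp only [batchRate, Matrix.mulVec, dotProduct, mul_one]

theorem hasSum_ofBlocks_mul (hD : IsBMAP D) {f : ℕ → ℝ} {k : ℕ} {i : ι}
    (hf : Summable fun m => batchRate D m i * f (k + (m + 1))) :
    HasSum (fun y => ofBlocks (bmapBlocks D μ) (k, i) y * f y.1) (levelDrift D μ f k i) := by
  have hs := hD.summable_ofBlocks_mul (μ := μ) hf
  rw [← (hasSum_mulVec_level hs).unique (hD.hasSum_bmapBlocks_mulVec hf)]
  exact hs.hasSum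

theorem ofBlocks_nonneg_of_ne (hD : IsBMAP D) (hμ : 0 ≤ μ) {x y : ℕ × ι} (hxy : x ≠ y) :
    0 ≤ ofBlocks (bmapBlocks D μ) x y := by
  obtain ⟨k, i⟩ := x
  obtain ⟨l, j⟩ := y
  rcases le_or_gt k l with hkl | hlk
  · obtain ⟨m, rfl⟩ := Nat.exists_eq_add_of_le hkl
    rw [ofBlocks_bmapBlocks_add hxy]
    rcases m.eq_zero_or_pos with rfl | hm
    · exact hD.offDiag_nonneg i j fun hij => hxy (by rw [hij, add_zero])
    · exact hD.nonneg m hm i j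
  · rcases (Nat.succ_le_of_lt hlk).eq_or_lt with rfl | h
    · rw [ofBlocks, bmapBlocks_succ_self, Matrix.smul_apply, Matrix.one_apply]
      split_ifs <;> simp only [smul_eq_mul, mul_one, mul_zero, le_refl]
      positivity
    · rw [ofBlocks, bmapBlocks_of_succ_lt h, Matrix.zero_apply]

theorem isConservativeGenerator (hD : IsBMAP D) (hμ : 0 ≤ μ) :
    IsConservativeGenerator (ofBlocks (bmapBlocks D μ)) where
  offDiag_nonneg _ _ := hD.ofBlocks_nonneg_of_ne hμ
  hasSum_row x := by
    have hone := hD.hasSum_ofBlocks_mul (μ := μ) (f := fun _ => 1) (k := x.1) (i := x.2)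
      (by simpa only [mul_one] using (hD.hasSum_batchRate x.2).summable)
    simpa only [levelDrift, sub_self, mul_zero, tsum_zero, add_zero, mul_one] using hone

end IsBMAP

end Arrivals

section Irreducible

/-- The state `y` can be reached from `x` along transitions of positive rate; a generator is
irreducible when this holds for all `x` and `y`. -/
def Reaches {S : Type*} (q : S → S → ℝ) (x y : S) : Prop :=
  Relation.ReflTransGen (fun a b => a ≠ b ∧ 0 < q a b) x y

variable {ι : Type*} [DecidableEq ι] {D : ℕ → Matrix ι ι ℝ} {μ : ℝ}

theorem reaches_of_level_le (hμ : 0 < μ) {k l : ℕ} (hkl : k ≤ l) (i : ι) :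
    Reaches (ofBlocks (bmapBlocks D μ)) (l, i) (k, i) := by
  induction l, hkl using Nat.le_induction with
  | base => exact .refl
  | succ l _ ih =>
    refine .head ⟨fun h => l.succ_ne_self (congrArg Prod.fst h), ?_⟩ ih
    rw [ofBlocks, bmapBlocks_succ_self, Matrix.smul_apply, Matrix.one_apply_eq, smul_eq_mul,
      mul_one]
    positivity

theorem reaches_add_of_pos {m k : ℕ} {i j : ι} (hne : (k, i) ≠ (k + m, j)) (hpos : 0 < D m i j) :
    Reaches (ofBlocks (bmapBlocks D μ)) (k, i) (k + m, j) :=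
  .single ⟨hne, by rwa [ofBlocks_bmapBlocks_add hne]⟩

variable [Fintype ι]

namespace IsBMAP

theorem exists_reaches_phase (hD : IsBMAP D) (i j : ι) (k : ℕ) :
    ∃ l, k ≤ l ∧ Reaches (ofBlocks (bmapBlocks D μ)) (k, i) (l, j) := by
  induction hD.irreducible i j with
  | refl => exact ⟨k, le_rfl, .refl⟩
  | @tail b c _ hbc ih =>
    obtain ⟨l, hkl, hl⟩ := ih
    obtain ⟨m, hm⟩ : ∃ m, 0 < D m b c := by
      by_contra! h
      exact hbc.2.not_ge (tsum_nonpos h)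
    exact ⟨l + m, by lia,
      hl.trans (reaches_add_of_pos (fun h => hbc.1 (congrArg Prod.snd h)) hm)⟩

omit [DecidableEq ι] in
theorem exists_arrival_pos (hD : IsBMAP D) : ∃ m i j, 0 < D (m + 1) i j := by
  obtain ⟨_ | m, hk, hne⟩ := hD.arrivals
  · exact absurd hk (Nat.not_succ_le_zero 0)
  · by_contra! h
    exact hne (Matrix.ext fun i j => le_antisymm (h m i j) (hD.nonneg _ hk i j))

theorem exists_reaches_above (hD : IsBMAP D) (x : ℕ × ι) (j : ι) (l : ℕ) :
    ∃ k, l ≤ k ∧ Reaches (ofBlocks (bmapBlocks D μ)) x (k, j) := by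
  obtain ⟨m, a, b, hpos⟩ := hD.exists_arrival_pos
  induction l generalizing j with
  | zero =>
    obtain ⟨k, -, hk⟩ := hD.exists_reaches_phase x.2 j x.1
    exact ⟨k, k.zero_le, hk⟩
  | succ l ih =>
    obtain ⟨k, hlk, hk⟩ := ih a
    obtain ⟨k', hk', hreach⟩ := hD.exists_reaches_phase b j (k + (m + 1))
    have hne : (k, a) ≠ (k + (m + 1), b) := fun h =>
      absurd (congrArg Prod.fst h) (by lia)
    exact ⟨k', by lia, (hk.trans (reaches_add_of_pos hne hpos)).trans hreach⟩

theorem isIrreducibleGenerator (hD : IsBMAP D) (hμ : 0 < μ) :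
    IsIrreducibleGenerator (ofBlocks (bmapBlocks D μ)) := fun x y =>
  let ⟨_, hk, hreach⟩ := hD.exists_reaches_above x y.2 y.1
  hreach.trans (reaches_of_level_le hμ hk y.2)

theorem isHessenbergGenerator (hD : IsBMAP D) (hμ : 0 < μ) :
    IsHessenbergGenerator (bmapBlocks D μ) where
  toIsConservativeGenerator := hD.isConservativeGenerator hμ.le
  irreducible := hD.isIrreducibleGenerator hμ
  eq_zero _ _ := bmapBlocks_of_succ_lt

end IsBMAP

end Irreducible

end Queue

section Drift

variable {ι : Type*} [Fintype ι] {D : ℕ → Matrix ι ι ℝ} {μ : ℝ}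

/-- The moment condition `∑ₖ (k + e) log (k + e) D_k e < ∞` on the batch sizes. -/
def HasFiniteBatchMoment (D : ℕ → Matrix ι ι ℝ) : Prop :=
  ∀ i, Summable fun m : ℕ => lyapV ((m + 1 : ℕ) : ℝ) * batchRate D m i

/-- The sum of `∑ₖ (k + e) log (k + e) D_k e` over the phases, a bound for it in each phase. -/
noncomputable def batchMoment (D : ℕ → Matrix ι ι ℝ) : ℝ :=
  ∑ i, ∑' m : ℕ, lyapV ((m + 1 : ℕ) : ℝ) * batchRate D m i

namespace IsBMAP

theorem lyapV_mul_batchRate_nonneg (hD : IsBMAP D) (m : ℕ) (i : ι) :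
    0 ≤ lyapV ((m + 1 : ℕ) : ℝ) * batchRate D m i :=
  mul_nonneg (lyapV_nonneg (Nat.cast_nonneg _)) (hD.batchRate_nonneg m i)

theorem batchMoment_nonneg (hD : IsBMAP D) : 0 ≤ batchMoment D :=
  Finset.sum_nonneg fun i _ => tsum_nonneg fun m => hD.lyapV_mul_batchRate_nonneg m i

section Increments

variable (hD : IsBMAP D) (hM : HasFiniteBatchMoment D) {g : ℕ → ℝ} {a : ℝ}
  (hg : ∀ m, 0 ≤ g m) (hga : ∀ m : ℕ, g m ≤ a * lyapV ((m + 1 : ℕ) : ℝ))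

include hD hga

theorem batchRate_mul_le (m : ℕ) (i : ι) :
    batchRate D m i * g m ≤ a * (lyapV ((m + 1 : ℕ) : ℝ) * batchRate D m i) :=
  (mul_le_mul_of_nonneg_left (hga m) (hD.batchRate_nonneg m i)).trans_eq (by ring)

include hM hg

theorem summable_batchRate_mul (i : ι) : Summable fun m => batchRate D m i * g m :=
  .of_nonneg_of_le (fun m => mul_nonneg (hD.batchRate_nonneg m i) (hg m))
    (fun m => hD.batchRate_mul_le hga m i) ((hM i).mul_left a)

theorem tsum_batchRate_mul_le (ha : 0 ≤ a) (i : ι) :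
    ∑' m, batchRate D m i * g m ≤ a * batchMoment D := by
  have hle : ∑' m : ℕ, lyapV ((m + 1 : ℕ) : ℝ) * batchRate D m i ≤ batchMoment D :=
    Finset.single_le_sum
      (f := fun i => ∑' m : ℕ, lyapV ((m + 1 : ℕ) : ℝ) * batchRate D m i)
      (fun i _ => tsum_nonneg fun m => hD.lyapV_mul_batchRate_nonneg m i) (Finset.mem_univ i)
  calc ∑' m, batchRate D m i * g m
      ≤ ∑' m : ℕ, a * (lyapV ((m + 1 : ℕ) : ℝ) * batchRate D m i) :=
        (hD.summable_batchRate_mul hM hg hga i).tsum_le_tsum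
          (fun m => hD.batchRate_mul_le hga m i) ((hM i).mul_left a)
    _ ≤ a * batchMoment D := by
        rw [tsum_mul_left]
        exact mul_le_mul_of_nonneg_left hle ha

end Increments

section Lyapunov

theorem summable_batchRate_mul_lyapV (hD : IsBMAP D) (hM : HasFiniteBatchMoment D) (k : ℕ) (i : ι) :
    Summable fun m => batchRate D m i * lyapV ((k + (m + 1) : ℕ) : ℝ) := by
  refine ((hD.summable_batchRate_mul hM (lyapV_increment_nonneg k) (lyapV_increment_le k) i).add
    ((hD.hasSum_batchRate i).summable.mul_right (lyapV k))).congr fun m => ?_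
  ring

theorem levelDrift_lyapV_le (hD : IsBMAP D) (hM : HasFiniteBatchMoment D) (hμ : 0 ≤ μ) (k : ℕ)
    (i : ι) : levelDrift D μ (fun l => lyapV l) k i ≤ (3 * batchMoment D - μ * k) * logShift k := by
  have hup := hD.tsum_batchRate_mul_le hM (lyapV_increment_nonneg k) (lyapV_increment_le k)
    (by linarith [one_le_logShift k.cast_nonneg]) i
  have hdown : k * μ * (lyapV ((k - 1 : ℕ) : ℝ) - lyapV k) ≤ k * μ * -logShift k := by
    cases k with
    | zero => simp
    | succ k =>
      refine mul_le_mul_of_nonneg_left ?_ (by positivity)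
      have hlog := logShift_le_lyapV_sub k.cast_nonneg
      rw [Nat.add_sub_cancel, Nat.cast_succ]
      linarith
  calc levelDrift D μ (fun l => lyapV l) k i
      ≤ k * μ * -logShift k + 3 * logShift k * batchMoment D := add_le_add hdown hup
    _ = (3 * batchMoment D - μ * k) * logShift k := by ring

variable [DecidableEq ι]

theorem hasSum_ofBlocks_mul_lyapV (hD : IsBMAP D) (hM : HasFiniteBatchMoment D) (x : ℕ × ι) :
    HasSum (fun y : ℕ × ι => ofBlocks (bmapBlocks D μ) x y * lyapV y.1)
      (levelDrift D μ (fun l => lyapV l) x.1 x.2) :=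
  hD.hasSum_ofBlocks_mul (f := fun l => lyapV l) (hD.summable_batchRate_mul_lyapV hM x.1 x.2)

theorem exists_isLevelLyapunov (hD : IsBMAP D) (hM : HasFiniteBatchMoment D) (hμ : 0 < μ) :
    ∃ b, IsLevelLyapunov (bmapBlocks D μ) (fun k => lyapV k) (μ / 2) b := by
  obtain ⟨A, hA⟩ : ∃ A, A = 3 * batchMoment D + μ / 2 * Real.exp 1 := ⟨_, rfl⟩
  have hA0 : 0 ≤ A := by
    have := hD.batchMoment_nonneg
    rw [hA]
    positivity
  refine ⟨A * logShift (A / (μ / 2)), half_pos hμ, fun k => lyapV_nonneg k.cast_nonneg,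
    fun k l hkl => lyapV_le_lyapV k.cast_nonneg (Nat.cast_le.2 hkl),
    tendsto_atTop_mono (fun k => self_le_lyapV k.cast_nonneg) tendsto_natCast_atTop_atTop,
    fun x => (hD.hasSum_ofBlocks_mul_lyapV hM x).summable, fun x => ?_⟩
  rw [(hD.hasSum_ofBlocks_mul_lyapV hM x).tsum_eq]
  calc levelDrift D μ (fun l => lyapV l) x.1 x.2
      ≤ (3 * batchMoment D - μ * x.1) * logShift x.1 := hD.levelDrift_lyapV_le hM hμ.le x.1 x.2
    _ = -(μ / 2) * lyapV x.1 + (A - μ / 2 * x.1) * logShift x.1 := by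
        rw [hA, lyapV, ← logShift]
        ring
    _ ≤ -(μ / 2) * lyapV x.1 + A * logShift (A / (μ / 2)) := by
        linarith [sub_mul_logShift_le hA0 (half_pos hμ) x.1.cast_nonneg]

end Lyapunov

section Logarithmic

theorem levelDrift_logShift_le (hD : IsBMAP D) (hM : HasFiniteBatchMoment D) (hμ : 0 ≤ μ) (k : ℕ)
    (i : ι) : levelDrift D μ (fun l => logShift l) k i ≤
      -μ + (3 * μ + batchMoment D) / (k + Real.exp 1) := by
  have hk : 0 < k + Real.exp 1 := by positivity
  have hup := hD.tsum_batchRate_mul_le hM (logShift_increment_nonneg k) (logShift_increment_le k)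
    (by positivity) i
  have hdown : k * μ * (logShift ((k - 1 : ℕ) : ℝ) - logShift k) ≤
      k * μ * -(1 / (k + Real.exp 1)) := by
    cases k with
    | zero => simp
    | succ k =>
      refine mul_le_mul_of_nonneg_left ?_ (by positivity)
      have hlog := one_div_le_logShift_sub k.cast_nonneg
      rw [Nat.add_sub_cancel, Nat.cast_succ]
      linarith
  calc levelDrift D μ (fun l => logShift l) k i
      ≤ k * μ * -(1 / (k + Real.exp 1)) + 1 / (k + Real.exp 1) * batchMoment D :=
        add_le_add hdown hup
    _ = -μ + (Real.exp 1 * μ + batchMoment D) / (k + Real.exp 1) := by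
        field_simp
        ring
    _ ≤ -μ + (3 * μ + batchMoment D) / (k + Real.exp 1) := by
        gcongr
        exact Real.exp_one_lt_three.le

variable [DecidableEq ι]

theorem hasSum_ofBlocks_mul_logVec (hD : IsBMAP D) (hM : HasFiniteBatchMoment D) (c : ℝ)
    (x : ℕ × ι) : HasSum (fun y => ofBlocks (bmapBlocks D μ) x y * logVec c y)
      (c * levelDrift D μ (fun l => logShift l) x.1 x.2) := by
  have hs : Summable fun m => batchRate D m x.2 * logShift ((x.1 + (m + 1) : ℕ) : ℝ) :=
    ((hD.summable_batchRate_mul hM (logShift_increment_nonneg x.1)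
      (logShift_increment_le x.1) x.2).add
      ((hD.hasSum_batchRate x.2).summable.mul_right (logShift x.1))).congr fun m => by ring
  simpa only [mul_left_comm c, logVec, logShift] using
    (hD.hasSum_ofBlocks_mul (μ := μ) (f := fun l => logShift l) hs).mul_left c

theorem driftCondition_logVec (hD : IsBMAP D) (hM : HasFiniteBatchMoment D) (hμ : 0 < μ) {c : ℝ}
    (hc : 1 < c * μ) : DriftCondition (ofBlocks (bmapBlocks D μ)) (logVec c) := by
  have hc0 : 0 < c := pos_of_mul_pos_left (zero_lt_one.trans hc) hμ.le
  have hB : 0 < c * (3 * μ + batchMoment D) := by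
    have := hD.batchMoment_nonneg
    positivity
  have hdrift (x : ℕ × ι) : ∑' y, ofBlocks (bmapBlocks D μ) x y * logVec c y ≤
      -(c * μ) + c * (3 * μ + batchMoment D) / (x.1 + Real.exp 1) := by
    rw [(hD.hasSum_ofBlocks_mul_logVec hM c x).tsum_eq]
    refine (mul_le_mul_of_nonneg_left (hD.levelDrift_logShift_le hM hμ.le x.1 x.2)
      hc0.le).trans_eq (by ring)
  obtain ⟨K, hK⟩ := exists_nat_ge (c * (3 * μ + batchMoment D) / (c * μ - 1))
  refine ⟨hD.isIrreducibleGenerator hμ, ⟨c, hc0, fun x =>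
      le_mul_of_one_le_right hc0.le (one_le_logShift x.1.cast_nonneg)⟩,
    fun x => (hD.hasSum_ofBlocks_mul_logVec hM c x).summable,
    _, hB, Finset.range K ×ˢ Finset.univ, fun x => (hdrift x).trans ?_⟩
  have hx : 0 < x.1 + Real.exp 1 := by positivity
  rcases lt_or_ge x.1 K with hxK | hxK
  · rw [Set.indicator_of_mem (by simpa using hxK), mul_one]
    have := div_le_self hB.le (one_le_add_exp_one x.1.cast_nonneg)
    linarith
  · rw [Set.indicator_of_notMem (by simpa using hxK), mul_zero]
    have hfar : c * (3 * μ + batchMoment D) / (x.1 + Real.exp 1) ≤ c * μ - 1 := by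
      rw [div_le_comm₀ hx (sub_pos.2 hc)]
      exact (hK.trans (Nat.cast_le.2 hxK)).trans (le_add_of_nonneg_right (Real.exp_pos 1).le)
    linarith

end Logarithmic

end IsBMAP

end Drift

section Main

variable {ι : Type*}

theorem logVec_pos {c : ℝ} (hc : 0 < c) (x : ℕ × ι) : 0 < logVec c x :=
  mul_pos hc (zero_lt_one.trans_le (one_le_logShift x.1.cast_nonneg))

theorem logVec_le_mul_lyapV {c : ℝ} (hc : 0 ≤ c) (x : ℕ × ι) : logVec c x ≤ c * lyapV x.1 :=
  mul_le_mul_of_nonneg_left (logShift_le_lyapV x.1.cast_nonneg) hc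

theorem momentCondition_of_abs_le_logVec {q : ℕ × ι → ℕ × ι → ℝ} {p v : ℕ × ι → ℝ} {a c : ℝ}
    (hq : ∀ x, |q x x| ≤ a * (x.1 + Real.exp 1)) (hp : ∀ x, 0 ≤ p x)
    (hpV : Summable fun x => p x * lyapV x.1) (hv : ∀ x, |v x| ≤ logVec c x) :
    MomentCondition q p v := by
  refine .of_norm_bounded (hpV.mul_left (a * c)) fun x => ?_
  rw [Real.norm_eq_abs, abs_mul, abs_mul, abs_abs, abs_of_nonneg (hp x)]
  calc p x * |q x x| * |v x| ≤ p x * (a * (x.1 + Real.exp 1)) * logVec c x :=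
        mul_le_mul (mul_le_mul_of_nonneg_left (hq x) (hp x)) (hv x) (abs_nonneg _)
          (mul_nonneg (hp x) ((abs_nonneg _).trans (hq x)))
    _ = a * c * (p x * lyapV x.1) := by
        rw [logVec, lyapV]
        ring

variable [Fintype ι] [DecidableEq ι] {D : ℕ → Matrix ι ι ℝ} {μ : ℝ}

theorem abs_ofBlocks_bmapBlocks_self_le_mul_lyapV (hμ : 0 ≤ μ) (x : ℕ × ι) :
    |ofBlocks (bmapBlocks D μ) x x| ≤ (∑ i, |D 0 i i| + μ) * lyapV x.1 :=
  (abs_ofBlocks_bmapBlocks_self_le hμ x).trans (mul_le_mul_of_nonneg_left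
    (add_exp_one_le_lyapV x.1.cast_nonneg)
    (add_nonneg (Finset.sum_nonneg fun _ _ => abs_nonneg _) hμ))

theorem IsBMAP.summable_ofBlocks_mul_of_abs_le (hD : IsBMAP D) (hM : HasFiniteBatchMoment D)
    {v : ℕ × ι → ℝ} {c : ℝ} (hv : ∀ x, |v x| ≤ c * lyapV x.1) (x : ℕ × ι) :
    Summable fun y => ofBlocks (bmapBlocks D μ) x y * v y := by
  refine .of_norm_bounded ((hD.hasSum_ofBlocks_mul_lyapV (μ := μ) hM x).summable.abs.mul_left c)
    fun y => ?_
  rw [Real.norm_eq_abs, abs_mul, abs_mul, mul_left_comm,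
    abs_of_nonneg (lyapV_nonneg y.1.cast_nonneg)]
  exact mul_le_mul_of_nonneg_left (hv y) (abs_nonneg _)

theorem mainTheorem7_general (hD : IsBMAP D) (hμ : 0 < μ) (hM : HasFiniteBatchMoment D) :
    (∃ K, ∃ θ : ℝ, 0 < θ ∧ ∀ k, K + 1 ≤ k → ∀ i,
      Summable (fun l : ℕ => (bmapBlocks D μ k l *ᵥ fun _ => lyapV l) i) ∧
      ∑' l : ℕ, (bmapBlocks D μ k l *ᵥ fun _ => lyapV l) i ≤ -θ * lyapV k ∧
      -θ * lyapV k ≤ -1) ∧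
    (∀ c, 1 < c * μ → DriftCondition (ofBlocks (bmapBlocks D μ)) (logVec c)) ∧
    ∃ p, IsStationaryDistribution (ofBlocks (bmapBlocks D μ)) p ∧
      (∀ p', IsStationaryDistribution (ofBlocks (bmapBlocks D μ)) p' → p' = p) ∧
      (∀ x, 0 < p x) ∧
      (∀ v c, (∀ x, |v x| ≤ logVec c x) →
        MomentCondition (ofBlocks (bmapBlocks D μ)) p v) ∧
      (∀ j : ℕ → ι, Tendsto (fun n => tvDist (approx (bmapBlocks D μ) j n) p) atTop (𝓝 0)) ∧
      ∀ v c, (∀ x, 0 < v x) → (∀ x, v x ≤ c * lyapV x.1) →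
        AlgorithmApplies (bmapBlocks D μ) v p := by
  have hQ := hD.isHessenbergGenerator hμ
  have hrate := abs_ofBlocks_bmapBlocks_self_le_mul_lyapV (D := D) hμ.le
  obtain ⟨b, hV⟩ := hD.exists_isLevelLyapunov hM hμ
  obtain ⟨-, i, -⟩ := hD.exists_arrival_pos
  have : Nonempty ι := ⟨i⟩
  obtain ⟨p, hp, hpV⟩ := hQ.exists_isStationaryDistribution hV
  have hlim := hQ.tendsto_tvDist_approx hV hrate hp
  refine ⟨hV.exists_drift, fun c => hD.driftCondition_logVec hM hμ, p, hp,
    fun _ => hQ.isStationaryDistribution_unique_of_rate_le (V := fun k => lyapV k) hrate hp hpV,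
    hQ.pos_of_isStationaryDistribution hQ.irreducible hp,
    fun v c => momentCondition_of_abs_le_logVec (abs_ofBlocks_bmapBlocks_self_le hμ.le) hp.nonneg
      hpV,
    hlim, fun v c hv hvV => ?_⟩
  have habs (x : ℕ × ι) : |v x| ≤ c * lyapV x.1 := (abs_of_pos (hv x)).trans_le (hvV x)
  exact hQ.algorithmApplies hv (hD.summable_ofBlocks_mul_of_abs_le hM habs)
    hp.hasSum_one.summable hlim

end Main

end BlockHessenberg

theorem mainTheorem7 {ι : Type*} [Fintype ι] [DecidableEq ι] [Nonempty ι]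
    (D : ℕ → Matrix ι ι ℝ) (hD : BlockHessenberg.IsBMAP D) (μ : ℝ) (hμ : 0 < μ)
    (C : ℝ) (hC : 0 < C)
    (hsum : ∀ i, Summable (fun k : ℕ =>
      BlockHessenberg.lyapV ((k + 1 : ℕ) : ℝ) * (D (k + 1)).mulVec (fun _ => 1) i))
    (hlt : ∀ i, ∑' k : ℕ,
      BlockHessenberg.lyapV ((k + 1 : ℕ) : ℝ) * (D (k + 1)).mulVec (fun _ => 1) i < C) :
    (∃ K : ℕ, ∃ θ : ℝ, 0 < θ ∧ ∀ k : ℕ, K + 1 ≤ k → ∀ i : ι,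
      Summable (fun l : ℕ =>
        (BlockHessenberg.bmapBlocks D μ k l).mulVec (fun _ => BlockHessenberg.lyapV l) i) ∧
      ∑' l : ℕ, (BlockHessenberg.bmapBlocks D μ k l).mulVec
        (fun _ => BlockHessenberg.lyapV l) i ≤ -θ * BlockHessenberg.lyapV k ∧
      -θ * BlockHessenberg.lyapV k ≤ -1) ∧
    (∀ c : ℝ, 1 < c * μ →
      BlockHessenberg.DriftCondition
        (BlockHessenberg.ofBlocks (BlockHessenberg.bmapBlocks D μ))
        (BlockHessenberg.logVec c)) ∧
    (∃ p : ℕ × ι → ℝ,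
      BlockHessenberg.IsStationaryDistribution
        (BlockHessenberg.ofBlocks (BlockHessenberg.bmapBlocks D μ)) p ∧
      (∀ p' : ℕ × ι → ℝ, BlockHessenberg.IsStationaryDistribution
        (BlockHessenberg.ofBlocks (BlockHessenberg.bmapBlocks D μ)) p' → p' = p) ∧
      (∀ x, 0 < p x) ∧
      ∀ c : ℝ, 0 < c →
        BlockHessenberg.MomentCondition
          (BlockHessenberg.ofBlocks (BlockHessenberg.bmapBlocks D μ)) p
          (BlockHessenberg.logVec c) ∧
        BlockHessenberg.AlgorithmApplies (BlockHessenberg.bmapBlocks D μ)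
          (BlockHessenberg.logVec c) p) := by
  obtain ⟨hlevel, hdrift, p, hp, huniq, hpos, hmoment, -, halg⟩ :=
    BlockHessenberg.mainTheorem7_general hD hμ hsum
  refine ⟨hlevel, hdrift, p, hp, huniq, hpos, fun c hc => ?_⟩
  have hlog := BlockHessenberg.logVec_pos (ι := ι) hc
  exact ⟨hmoment _ c fun x => (abs_of_pos (hlog x)).le,
    halg _ c hlog (BlockHessenberg.logVec_le_mul_lyapV hc.le)⟩
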